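/- Let $n\ge 1$, $q,t\in\mathbb{C}^\ast$ with $|q|<1$, and let $s=(s_1,\ldots,s_n)\in(\mathbb{C}^\ast)^n$ satisfy $s_j/s_i\notin q^{\mathbb{Z}\setminus\{0\}}$ for $1\le i<j\le n$. Put $\theta(z;p)=(z;p)_\infty(p/z;p)_\infty$ with $(z;p)_\infty=\prod_{i\ge0}(1-p^iz)$. For $r=1,\ldots,n$ let $$\mathcal{E}^{(r)}_{x,s}(p)=\sum_{I\subseteq\{1,\ldots,n\},\,|I|=r}\Big(\prod_{i\in I}s_i\Big)\,\mathcal{B}_I(x;p)\prod_{i\in I}T_{q,x_i},\qquad \mathcal{B}_I(x;p)=\prod_{\substack{i<j\\ i\in I,\,j\notin I}}\frac{\theta(x_j/tx_i;p)}{\theta(x_j/x_i;p)}\prod_{\substack{i<j\\ i\notin I,\,j\in I}}\frac{\theta(tx_j/x_i;p)}{\theta(x_j/x_i;p)},$$ where $T_{q,x_i}$ is the shift $x_i\mapsto qx_i$; these are the modified elliptic Ruijsenaars operators, acting on $\mathbb{C}[[px_1/x_n,x_2/x_1,\ldots,x_n/x_{n-1}]]$, where $\mathbb{C}[[p]]$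 is contained in this ring through $p=(px_1/x_n)(x_2/x_1)\cdots(x_n/x_{n-1})$. The normalized Ruijsenaars function $f(x;s;p)=f(x;s;p|q,t)$ is the (unique) solution in this ring of the joint eigenvalue problem $$\mathcal{E}^{(r)}_{x,s}(p)f(x;s;p)=\varepsilon^{(r)}(s;p)f(x;s;p)\quad(r=1,\ldots,n),\qquad \varepsilon^{(r)}(s;p)\in\mathbb{C}[[p]],$$ whose constant term with respect to $x$ (an element of $\mathbb{C}[[p]]$) is $1$. Then: (1) $f(x_2,\ldots,x_n,px_1;\,s_2,\ldots,s_n,s_1;\,p)=f(x_1,\ldots,x_n;\,s_1,\ldots,s_n;\,p)$ as formal power series, where the left side is obtained by the substitution $px_1/x_n\mapsto x_2/x_1\mapsto x_3/x_2\mapsto\cdots\mapsto x_n/x_{n-1}\mapsto px_1/x_n$. (2) The same identity holds for the sums of the series at complex numbers: for all $p\in\mathbb{C}^\ast$ and $x\in(\mathbb{C}^\ast)^n$, the series $f(x_2,\ldots,x_n,px_1;s_2,\ldots,s_n,s_1;p)$ converges absolutely if and only if the series $f(x;s;p)$ does, and then the two sums are equal. (3) $\varepsilon^{(r)}(s_2,\ldots,s_n,s_1;p)=\varepsilon^{(r)}(s_1,\ldots,s_n;p)$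 for $r=1,\ldots,n$. -/

import Mathlib

namespace Ruijsenaars

noncomputable section

/- Conventions.  The coordinates `x₁, …, xₙ` and the parameters `s₁, …, sₙ` are indexed by `Fin n`
(from `0` to `n - 1`), with the cyclic addition of `Fin n`.  The ring
`ℂ⟦p x₁ / xₙ, x₂ / x₁, …, xₙ / xₙ₋₁⟧` is `MvPowerSeries (Fin n) ℂ`: the variable `X 0` stands for
`z₀ = p x₁ / xₙ` and, for `k ≠ 0`, the variable `X k` stands for `z_k = x_{k+1} / x_k`
(that is, `x k / x (k - 1)` in the indexing by `Fin n`).  In particular `z₀ z₁ ⋯ zₙ₋₁ = p`. -/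

variable {n : ℕ}

/-- The ring `ℂ⟦p x₁ / xₙ, x₂ / x₁, …, xₙ / xₙ₋₁⟧`. -/
abbrev AsympSeries (n : ℕ) : Type := MvPowerSeries (Fin n) ℂ

/-- The elliptic nome `p = z₀ z₁ ⋯ zₙ₋₁`. -/
def nome (n : ℕ) : AsympSeries n := ∏ k : Fin n, MvPowerSeries.X k

/-- For `i < j`, the ratio `x_j / x_i`, a product of consecutive variables. -/
def ratio (i j : Fin n) : AsympSeries n := ∏ k ∈ Finset.Ioc i j, MvPowerSeries.X k

/-- For `i < j`, the element `p x_i / x_j`, the product of the remaining variables. -/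
def coratio (i j : Fin n) : AsympSeries n := ∏ k ∈ (Finset.Ioc i j)ᶜ, MvPowerSeries.X k

/-- The infinite shifted factorial `(a; p)_∞ = ∏_{i ≥ 0} (1 - p ^ i a)` as a formal power series.
Since `p ^ i` only involves monomials of degree at least `i` (for `n ≥ 1`), the factors with
`i > deg β` do not contribute to the coefficient of `z ^ β`, and that coefficient is the one of
the partial product over `i ≤ deg β`. -/
def pochhammer (a : AsympSeries n) : AsympSeries n := fun β : Fin n →₀ ℕ =>
  MvPowerSeries.coeff β (∏ i ∈ Finset.range (β.degree + 1), (1 - nome n ^ i * a))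

/-- For `i < j` and `c ≠ 0`, the theta function
`θ(c x_j / x_i; p) = (c x_j / x_i; p)_∞ (c⁻¹ p x_i / x_j; p)_∞`. -/
def theta (c : ℂ) (i j : Fin n) : AsympSeries n :=
  pochhammer (MvPowerSeries.C c * ratio i j) * pochhammer (MvPowerSeries.C c⁻¹ * coratio i j)

/-- The coefficient `𝓑_I(x; p)`: the product of `θ(t⁻¹ x_j / x_i; p) / θ(x_j / x_i; p)` over the
pairs `i < j` with `i ∈ I`, `j ∉ I`, and of `θ(t x_j / x_i; p) / θ(x_j / x_i; p)` over the pairs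
`i < j` with `i ∉ I`, `j ∈ I`.  The denominators have constant coefficient `1`. -/
def opCoeff (t : ℂ) (I : Finset (Fin n)) : AsympSeries n :=
  (∏ i ∈ I, ∏ j ∈ Iᶜ with i < j, theta t⁻¹ i j * (theta 1 i j)⁻¹) *
    ∏ i ∈ Iᶜ, ∏ j ∈ I with i < j, theta t i j * (theta 1 i j)⁻¹

/-- The `q`-shift operator `T_{q,x}^I = ∏_{i ∈ I} T_{q,x_i}`, `T_{q,x_i} : x_i ↦ q x_i`.
The exponent of `x_i` in `z ^ β` is `β i - β (i + 1)` (cyclically). -/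
def qShift [NeZero n] (q : ℂ) (I : Finset (Fin n)) (f : AsympSeries n) : AsympSeries n :=
  fun β : Fin n →₀ ℕ => (∏ i ∈ I, q ^ ((β i : ℤ) - (β (i + 1) : ℤ))) * MvPowerSeries.coeff β f

/-- The modified elliptic Ruijsenaars operator
`𝓔^{(r)}_{x,s}(p) = ∑_{|I| = r} s^I 𝓑_I(x; p) T_{q,x}^I`. -/
def modifiedOp [NeZero n] (q t : ℂ) (s : Fin n → ℂ) (r : ℕ) (f : AsympSeries n) :
    AsympSeries n :=
  ∑ I ∈ (Finset.univ : Finset (Fin n)).powersetCard r,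
    MvPowerSeries.C (∏ i ∈ I, s i) * opCoeff t I * qShift q I f

/-- The inclusion of `ℂ⟦p⟧`, `∑ ε_k p ^ k ↦ ∑ ε_k (z₀ z₁ ⋯ zₙ₋₁) ^ k`. -/
def ofNomeSeries [NeZero n] (ε : PowerSeries ℂ) : AsympSeries n := fun β : Fin n →₀ ℕ =>
  if ∀ i, β i = β 0 then PowerSeries.coeff (β 0) ε else 0

/-- `f` is a normalized formal solution, with eigenvalues `ε r` (`r = 1, …, n`), of the joint
eigenvalue problem `𝓔^{(r)}_{x,s}(p) f = ε^{(r)} f`.  Normalized means that the constant term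
`∑_k p ^ k f_{k,k,…,k}` of `f` with respect to `x` is `1`. -/
structure IsNormalizedSolution [NeZero n] (q t : ℂ) (s : Fin n → ℂ) (f : AsympSeries n)
    (ε : ℕ → PowerSeries ℂ) : Prop where
  eigen : ∀ r ∈ Finset.Icc 1 n, modifiedOp q t s r f = ofNomeSeries (ε r) * f
  normalized : ∀ k : ℕ, MvPowerSeries.coeff (Finsupp.equivFunOnFinite.symm fun _ : Fin n => k) f =
    if k = 0 then 1 else 0

/-- The normalized solution together with its eigenvalues. -/
def solution [NeZero n] (q t : ℂ) (s : Fin n → ℂ) : AsympSeries n × (ℕ → PowerSeries ℂ) :=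
  Classical.epsilon fun u => IsNormalizedSolution q t s u.1 u.2

/-- The normalized Ruijsenaars function `f(x; s; p | q, t)` as a formal power series. -/
def series [NeZero n] (q t : ℂ) (s : Fin n → ℂ) : AsympSeries n := (solution q t s).1

/-- The eigenvalue `ε^{(r)}(s; p) ∈ ℂ⟦p⟧`, for `r = 1, …, n`. -/
def eigenvalue [NeZero n] (q t : ℂ) (s : Fin n → ℂ) (r : ℕ) : PowerSeries ℂ :=
  (solution q t s).2 r

theorem isNormalizedSolution_series [NeZero n] {q t : ℂ} {s : Fin n → ℂ}
    (h : ∃ f ε, IsNormalizedSolution q t s f ε) :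
    IsNormalizedSolution q t s (series q t s) (eigenvalue q t s) := by
  obtain ⟨f, ε, hf⟩ := h
  exact Classical.epsilon_spec
    (p := fun u : AsympSeries n × (ℕ → PowerSeries ℂ) => IsNormalizedSolution q t s u.1 u.2)
    ⟨(f, ε), hf⟩

/-- The numbers `z₀ = p x₁ / xₙ`, `z₁ = x₂ / x₁`, …, `zₙ₋₁ = xₙ / xₙ₋₁` at a point `x`. -/
def asympVar [NeZero n] (p : ℂ) (x : Fin n → ℂ) (k : Fin n) : ℂ :=
  if k = 0 then p * x 0 / x (-1) else x k / x (k - 1)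

/-- The term of index `β` of the series `f(x; s; p)` at numbers `x` and `p`. -/
def term [NeZero n] (q t : ℂ) (x s : Fin n → ℂ) (p : ℂ) (β : Fin n →₀ ℕ) : ℂ :=
  MvPowerSeries.coeff β (series q t s) * ∏ k, asympVar p x k ^ β k

/-- The value `f(x; s; p)` of the normalized Ruijsenaars function, the sum of its series. -/
def ruijsenaars [NeZero n] (q t : ℂ) (x s : Fin n → ℂ) (p : ℂ) : ℂ :=
  ∑' β : Fin n →₀ ℕ, term q t x s p β

/-- `(s₁, …, sₙ) ↦ (s₂, …, sₙ, s₁)`. -/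
def rotateParam [NeZero n] (s : Fin n → ℂ) : Fin n → ℂ := fun i => s (i + 1)

/-- `(x₁, …, xₙ) ↦ (x₂, …, xₙ, p x₁)`; the last index is the `i` with `i + 1 = 0`. -/
def rotatePoint [NeZero n] (p : ℂ) (x : Fin n → ℂ) : Fin n → ℂ := fun i =>
  if i + 1 = 0 then p * x 0 else x (i + 1)

/-- The substitution `f(x; p) ↦ f(x₂, …, xₙ, p x₁; p)` on formal power series.  It sends `z_k` to
`z_{k+1}` (cyclically), so the coefficient of `∏ z_k ^ β_k` in the result is the coefficient of
`∏ z_k ^ β_{k+1}` in `f`. -/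
def rotateSeries [NeZero n] (f : AsympSeries n) : AsympSeries n := fun β : Fin n →₀ ℕ =>
  MvPowerSeries.coeff (Finsupp.equivFunOnFinite.symm fun k : Fin n => β (k + 1)) f

end

end Ruijsenaars

/-!
The substitution `z_k ↦ z_{k+1}` turns the operators with parameters `(s₂, …, sₙ, s₁)` into those
with parameters `s`, so everything follows from existence and uniqueness of the normalized solution.

All operators are triangular with respect to the degree in `z`, and a linear combination of them
whose diagonal entries separate the nonconstant monomials `z ^ β` from `1` has exactly one
normalized eigenfunction; operators commuting with the combination then share it. For generic `s`
such a combination exists, because up to a constant the diagonal entries of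
`∑ (-u) ^ r 𝓔^{(r)}` are the values at `u` of the polynomials `∏ (1 - s_i q ^ {l_i} u)`, whose roots
determine `l` up to the genericity condition.

It remains to show that the operators commute. For `𝓔^{(1)}` and `𝓔^{(r)}` this is a theta function
identity, the elliptic partial fraction expansion
`∑ᵢ ∏ⱼ θ(aᵢ/bⱼ) / ∏_{j ≠ i} θ(aᵢ/aⱼ) = 0` for `∏ aᵢ = ∏ bᵢ`, obtained from the fact that a formal
theta series of order `n` is determined by its values at `n` generic points. If the sums
`∑ s_i q ^ {l_i}` are pairwise distinct, then `𝓔^{(1)}` alone has a unique normalized eigenfunction,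
which diagonalizes every `𝓔^{(r)}`, and comparison of coefficients forces all commutators to vanish.
The coefficients of a commutator are polynomials in `s`, so they vanish for all `s`.
-/

namespace Ruijsenaars

open scoped PowerSeries LaurentPolynomial

/-! ### Theta functions as formal power series in the nome -/

section FormalTheta

variable {R S : Type*} [CommRing R] [CommRing S]

/-- The partial product `∏_{1 ≤ i ≤ N} (1 - a X ^ i)`. -/
noncomputable def eulerPartial (a : R) (N : ℕ) : R⟦X⟧ :=
  ∏ i ∈ Finset.range N, (1 - PowerSeries.C a * PowerSeries.X ^ (i + 1))

/-- The infinite product `(a X; X)_∞ = ∏_{i ≥ 1} (1 - a X ^ i)`; only the factors with `i ≤ k`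
contribute to the coefficient of `X ^ k`. -/
noncomputable def eulerProd (a : R) : R⟦X⟧ :=
  PowerSeries.mk fun k => PowerSeries.coeff k (eulerPartial a k)

lemma coeff_eulerProd (a : R) {k N : ℕ} (h : k ≤ N) :
    PowerSeries.coeff k (eulerProd a) = PowerSeries.coeff k (eulerPartial a N) := by
  induction N, h using Nat.le_induction with
  | base => exact PowerSeries.coeff_mk _ _
  | succ N hN ih =>
    rw [ih, eulerPartial, eulerPartial, Finset.prod_range_succ, mul_sub, mul_one, map_sub,
      ← mul_assoc, PowerSeries.coeff_mul_X_pow', if_neg (by omega), sub_zero]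

lemma map_eulerPartial (f : R →+* S) (a : R) (N : ℕ) :
    (eulerPartial a N).map f = eulerPartial (f a) N := by
  simp [eulerPartial, map_prod]

lemma map_eulerProd (f : R →+* S) (a : R) : (eulerProd a).map f = eulerProd (f a) := by
  ext k
  simp [eulerProd, ← map_eulerPartial f a k]

lemma constantCoeff_eulerProd (a : R) : PowerSeries.constantCoeff (eulerProd a) = 1 := by
  rw [← PowerSeries.coeff_zero_eq_constantCoeff_apply, coeff_eulerProd a le_rfl]
  simp [eulerPartial]

/-- The theta function `θ(u; X) = (u; X)_∞ (X / u; X)_∞` at a unit `u`, a power series in the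
nome `X`. -/
noncomputable def thetaSeries (u : Rˣ) : R⟦X⟧ :=
  (1 - PowerSeries.C (u : R)) * eulerProd (u : R) * eulerProd (↑u⁻¹ : R)

lemma thetaSeries_one : thetaSeries (1 : Rˣ) = 0 := by simp [thetaSeries]

lemma thetaSeries_inv (u : Rˣ) :
    thetaSeries u⁻¹ = -(PowerSeries.C (↑u⁻¹ : R) * thetaSeries u) := by
  have h : PowerSeries.C (↑u⁻¹ : R) * PowerSeries.C (u : R) = 1 := by
    rw [← map_mul, Units.inv_mul, map_one]
  simp only [thetaSeries, inv_inv]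
  linear_combination (-(eulerProd (u : R) * eulerProd (↑u⁻¹ : R))) * h

lemma map_thetaSeries (f : R →+* S) (u : Rˣ) :
    (thetaSeries u).map f = thetaSeries (Units.map f.toMonoidHom u) := by
  simp only [thetaSeries, map_mul, map_sub, map_one, map_eulerProd, PowerSeries.map_C]
  rfl

lemma constantCoeff_thetaSeries (u : Rˣ) :
    PowerSeries.constantCoeff (thetaSeries u) = 1 - u := by
  simp [thetaSeries, constantCoeff_eulerProd]

lemma coeff_mul_congr {f f' g g' : R⟦X⟧} {k : ℕ}
    (hf : ∀ j ≤ k, PowerSeries.coeff j f = PowerSeries.coeff j f')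
    (hg : ∀ j ≤ k, PowerSeries.coeff j g = PowerSeries.coeff j g') :
    ∀ j ≤ k, PowerSeries.coeff j (f * g) = PowerSeries.coeff j (f' * g') := by
  intro j hj
  rw [PowerSeries.coeff_mul, PowerSeries.coeff_mul]
  refine Finset.sum_congr rfl fun x hx => ?_
  have := Finset.HasAntidiagonal.mem_antidiagonal.1 hx
  rw [hf _ (by omega), hg _ (by omega)]

lemma coeff_thetaSeries (u : Rˣ) {k N M : ℕ} (hN : k ≤ N) (hM : k ≤ M) :
    ∀ j ≤ k, PowerSeries.coeff j (thetaSeries u) =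
      PowerSeries.coeff j ((1 - PowerSeries.C (u : R)) * eulerPartial (u : R) N *
        eulerPartial (↑u⁻¹ : R) M) :=
  coeff_mul_congr (coeff_mul_congr (fun _ _ => rfl)
    fun _ h => coeff_eulerProd _ (h.trans hN)) fun _ h => coeff_eulerProd _ (h.trans hM)

end FormalTheta

/-! ### The substitution `T ↦ X T` -/

section Shift

variable {R : Type*} [CommRing R]

/-- The coefficient of `X ^ k T ^ l`, for arbitrary integers `k` and `l`. -/
noncomputable def bicoeff (g : R[T;T⁻¹]⟦X⟧) (k l : ℤ) : R :=
  if 0 ≤ k then (PowerSeries.coeff k.toNat g).coeff l else 0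

lemma bicoeff_natCast (g : R[T;T⁻¹]⟦X⟧) (k : ℕ) (l : ℤ) :
    bicoeff g k l = (PowerSeries.coeff k g).coeff l := by simp [bicoeff]

lemma bicoeff_of_neg (g : R[T;T⁻¹]⟦X⟧) {k : ℤ} (hk : k < 0) (l : ℤ) : bicoeff g k l = 0 :=
  if_neg hk.not_ge

lemma bicoeff_sub (g h : R[T;T⁻¹]⟦X⟧) (k l : ℤ) :
    bicoeff (g - h) k l = bicoeff g k l - bicoeff h k l := by
  unfold bicoeff; split_ifs <;> simp

lemma bicoeff_congr {g h : R[T;T⁻¹]⟦X⟧} {N : ℕ}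
    (hgh : ∀ j ≤ N, PowerSeries.coeff j g = PowerSeries.coeff j h) {k : ℤ} (hk : k ≤ N) (l : ℤ) :
    bicoeff g k l = bicoeff h k l := by
  unfold bicoeff
  split_ifs
  · rw [hgh _ (by omega)]
  · rfl

lemma laurentCoeff_mul (f g : R[T;T⁻¹]) (l : ℤ) {s : Finset ℤ} (hs : f.coeff.support ⊆ s) :
    (f * g).coeff l = ∑ m ∈ s, f.coeff m * g.coeff (l - m) := by
  rw [← Finset.sum_subset hs fun m _ hm => by rw [Finsupp.notMem_support_iff.1 hm, zero_mul]]
  conv_lhs => rw [← AddMonoidAlgebra.sum_coeff_single f]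
  rw [Finsupp.sum, Finset.sum_mul, AddMonoidAlgebra.coeff_sum, Finsupp.finsetSum_apply]
  exact Finset.sum_congr rfl fun m _ =>
    AddMonoidAlgebra.coeff_single_mul_eq_mul_coeff (l - m) fun _ _ => by omega

lemma bicoeff_natCast_mul (g h : R[T;T⁻¹]⟦X⟧) (k : ℕ) (l : ℤ) {s : Finset ℤ}
    (hs : ∀ i ≤ k, (PowerSeries.coeff i g).coeff.support ⊆ s) :
    bicoeff (g * h) k l =
      ∑ i ∈ Finset.range (k + 1), ∑ m ∈ s, bicoeff g i m * bicoeff h (k - i) (l - m) := by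
  rw [bicoeff_natCast, PowerSeries.coeff_mul, Finset.Nat.sum_antidiagonal_eq_sum_range_succ_mk,
    AddMonoidAlgebra.coeff_sum, Finsupp.finsetSum_apply]
  refine Finset.sum_congr rfl fun i hi => ?_
  have hik : i ≤ k := Nat.lt_succ_iff.1 (Finset.mem_range.1 hi)
  rw [laurentCoeff_mul _ _ _ (hs i hik)]
  simp only [← Nat.cast_sub hik, bicoeff_natCast]

lemma bicoeff_mul (g h : R[T;T⁻¹]⟦X⟧) (k l : ℤ) :
    bicoeff (g * h) k l =
      ∑ᶠ x : ℤ × ℤ, bicoeff g x.1 x.2 * bicoeff h (k - x.1) (l - x.2) := by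
  classical
  have hzero (x : ℤ × ℤ) (hx : x.1 < 0 ∨ k < x.1) :
      bicoeff g x.1 x.2 * bicoeff h (k - x.1) (l - x.2) = 0 := by
    rcases hx with hx | hx
    · rw [bicoeff_of_neg g hx, zero_mul]
    · rw [bicoeff_of_neg h (by omega), mul_zero]
  rcases lt_or_ge k 0 with hk | hk
  · rw [bicoeff_of_neg _ hk, finsum_eq_zero_of_forall_eq_zero fun x => hzero x (by omega)]
  lift k to ℕ using hk
  set s : Finset ℤ := (Finset.range (k + 1)).biUnion
    fun i => (PowerSeries.coeff i g).coeff.support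
  have hsub (i : ℕ) (hi : i ≤ k) : (PowerSeries.coeff i g).coeff.support ⊆ s :=
    Finset.subset_biUnion_of_mem (fun i => (PowerSeries.coeff i g).coeff.support)
      (Finset.mem_range.2 (Nat.lt_succ_of_le hi))
  rw [bicoeff_natCast_mul g h k l hsub, finsum_eq_sum_of_support_subset
      (s := ((Finset.range (k + 1)).map Nat.castEmbedding) ×ˢ s), Finset.sum_product,
    Finset.sum_map]
  · rfl
  rintro ⟨a, b⟩ hx
  have ha : 0 ≤ a ∧ a ≤ k := by
    by_contra hcon
    exact hx (hzero (a, b) (by dsimp only; omega))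
  obtain ⟨i, rfl⟩ := Int.eq_ofNat_of_zero_le ha.1
  have hik : i ≤ k := by exact_mod_cast ha.2
  refine Finset.mem_coe.2 (Finset.mem_product.2 ⟨Finset.mem_map.2
    ⟨i, Finset.mem_range.2 (Nat.lt_succ_of_le hik), rfl⟩, hsub i hik ?_⟩)
  rw [Finsupp.mem_support_iff, ← bicoeff_natCast]
  exact left_ne_zero_of_mul hx

/-- `IsShift g g'` means `g'(T) = g(X T)`.  This is a relation because the substitution need not
lead to Laurent polynomial coefficients. -/
def IsShift (g g' : R[T;T⁻¹]⟦X⟧) : Prop :=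
  ∀ k l : ℤ, bicoeff g' k l = bicoeff g (k - l) l

lemma IsShift.mul {g g' h h' : R[T;T⁻¹]⟦X⟧} (hg : IsShift g g') (hh : IsShift h h') :
    IsShift (g * h) (g' * h') := by
  intro k l
  rw [bicoeff_mul, bicoeff_mul]
  let e : ℤ × ℤ ≃ ℤ × ℤ :=
    ⟨fun x => (x.1 - x.2, x.2), fun x => (x.1 + x.2, x.2), fun x => by simp, fun x => by simp⟩
  refine Eq.trans (finsum_congr fun x => ?_) (finsum_comp_equiv e)
  simp only [e, Equiv.coe_fn_mk]
  rw [hg, hh, show k - x.1 - (l - x.2) = k - l - (x.1 - x.2) by ring]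

lemma IsShift.sub {g g' h h' : R[T;T⁻¹]⟦X⟧} (hg : IsShift g g') (hh : IsShift h h') :
    IsShift (g - h) (g' - h') := by
  intro k l
  rw [bicoeff_sub, bicoeff_sub, hg, hh]

lemma bicoeff_monomial (i : ℕ) (m : ℤ) (c : R) (k l : ℤ) :
    bicoeff (PowerSeries.monomial i (AddMonoidAlgebra.single m c : R[T;T⁻¹])) k l =
      if k = i ∧ l = m then c else 0 := by
  classical
  rcases lt_or_ge k 0 with hk | hk
  · rw [bicoeff_of_neg _ hk, if_neg (by omega)]
  lift k to ℕ using hk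
  rw [bicoeff_natCast, PowerSeries.coeff_monomial]
  by_cases hki : k = i
  · simp only [hki, if_true, true_and, AddMonoidAlgebra.coeff_single, Finsupp.single_apply,
      eq_comm]
  · simp [hki]

lemma isShift_monomial (c : R) {i j : ℕ} {m : ℤ} (h : (j : ℤ) = i + m) :
    IsShift (PowerSeries.monomial i (AddMonoidAlgebra.single m c : R[T;T⁻¹]))
      (PowerSeries.monomial j (AddMonoidAlgebra.single m c)) := by
  intro k l
  rw [bicoeff_monomial, bicoeff_monomial]
  exact if_congr (by omega) rfl rfl

lemma isShift_one : IsShift (1 : R[T;T⁻¹]⟦X⟧) 1 := by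
  simpa using isShift_monomial (1 : R) (i := 0) (j := 0) (m := 0) rfl

lemma isShift_prod {ι : Type*} (s : Finset ι) (g g' : ι → R[T;T⁻¹]⟦X⟧)
    (h : ∀ i, IsShift (g i) (g' i)) : IsShift (∏ i ∈ s, g i) (∏ i ∈ s, g' i) :=
  Finset.prod_hom_rel isShift_one fun i _ _ hi => (h i).mul hi

lemma isShift_map_C (f : R⟦X⟧) :
    IsShift (f.map (LaurentPolynomial.C : R →+* R[T;T⁻¹])) (f.map LaurentPolynomial.C) := by
  have hzero (k l : ℤ) (hl : l ≠ 0) :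
      bicoeff (f.map (LaurentPolynomial.C : R →+* R[T;T⁻¹])) k l = 0 := by
    unfold bicoeff
    split_ifs
    · rw [PowerSeries.coeff_map, ← LaurentPolynomial.single_eq_C, AddMonoidAlgebra.coeff_single,
        Finsupp.single_eq_of_ne hl]
    · rfl
  intro k l
  by_cases hl : l = 0
  · simp [hl]
  · rw [hzero _ _ hl, hzero _ _ hl]

lemma isShift_one_sub (c : R) {i j : ℕ} {m : ℤ} (h : (j : ℤ) = i + m) :
    IsShift (1 - PowerSeries.C (AddMonoidAlgebra.single m c : R[T;T⁻¹]) * PowerSeries.X ^ i)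
      (1 - PowerSeries.C (AddMonoidAlgebra.single m c) * PowerSeries.X ^ j) := by
  simp only [← PowerSeries.monomial_eq_C_mul_X_pow]
  exact isShift_one.sub (isShift_monomial c h)

/-- The Laurent monomial `T / b`. -/
noncomputable def unitTDiv (b : Rˣ) : R[T;T⁻¹]ˣ where
  val := AddMonoidAlgebra.single 1 ↑b⁻¹
  inv := AddMonoidAlgebra.single (-1) ↑b
  val_inv := by simp [AddMonoidAlgebra.single_mul_single, -LaurentPolynomial.single_eq_C_mul_T,
    AddMonoidAlgebra.one_def]
  inv_val := by simp [AddMonoidAlgebra.single_mul_single, -LaurentPolynomial.single_eq_C_mul_T,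
    AddMonoidAlgebra.one_def]

lemma coe_unitTDiv (b : Rˣ) : (unitTDiv b : R[T;T⁻¹]) = AddMonoidAlgebra.single 1 ↑b⁻¹ := rfl

lemma coe_inv_unitTDiv (b : Rˣ) :
    (↑(unitTDiv b)⁻¹ : R[T;T⁻¹]) = AddMonoidAlgebra.single (-1) ↑b := rfl

lemma isShift_eulerPartial (b : Rˣ) (N : ℕ) {v w : R[T;T⁻¹]} (hv : v = unitTDiv b)
    (hw : w = ↑(unitTDiv b)⁻¹) :
    IsShift ((1 - PowerSeries.C v) * eulerPartial v N * eulerPartial w (N + 1))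
      (PowerSeries.C (-w) * ((1 - PowerSeries.C v) * eulerPartial v (N + 1) *
        eulerPartial w N)) := by
  have hzero : IsShift (1 - PowerSeries.C v) (1 - PowerSeries.C v * PowerSeries.X ^ 1) := by
    simpa only [pow_zero, mul_one, hv, coe_unitTDiv] using
      isShift_one_sub (↑b⁻¹ : R) (i := 0) (j := 1) (m := 1) rfl
  have hup : IsShift (eulerPartial v N)
      (∏ i ∈ Finset.range N, (1 - PowerSeries.C v * PowerSeries.X ^ (i + 1 + 1))) := by
    rw [hv]
    exact isShift_prod _ _ _ fun i => isShift_one_sub _ (by push_cast; ring)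
  have hdown : IsShift (eulerPartial w (N + 1))
      (∏ i ∈ Finset.range (N + 1), (1 - PowerSeries.C w * PowerSeries.X ^ i)) := by
    rw [hw]
    exact isShift_prod _ _ _ fun i => isShift_one_sub _ (by push_cast; ring)
  have hwv : PowerSeries.C w * PowerSeries.C v = 1 := by
    rw [← map_mul, hv, hw, Units.inv_mul, map_one]
  convert (hzero.mul hup).mul hdown using 1
  simp only [eulerPartial, Finset.prod_range_succ' _ N, zero_add, pow_zero, mul_one, map_neg]
  linear_combination ((∏ i ∈ Finset.range N, (1 - PowerSeries.C v * PowerSeries.X ^ (i + 1 + 1))) *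
    (1 - PowerSeries.C v * PowerSeries.X ^ 1) *
    ∏ i ∈ Finset.range N, (1 - PowerSeries.C w * PowerSeries.X ^ (i + 1))) * hwv

theorem isShift_thetaSeries (b : Rˣ) :
    IsShift (thetaSeries (unitTDiv b))
      (PowerSeries.C (-(↑(unitTDiv b)⁻¹ : R[T;T⁻¹])) * thetaSeries (unitTDiv b)) := by
  intro k l
  set N := (max k (k - l)).toNat
  rw [bicoeff_congr (coeff_mul_congr (fun _ _ => rfl)
      (coeff_thetaSeries _ N.le_succ le_rfl)) (by omega),
    bicoeff_congr (coeff_thetaSeries _ le_rfl N.le_succ) (k := k - l) (by omega)]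
  exact isShift_eulerPartial b N rfl rfl k l

/-- `h(X T) = c T ^ (-M) h(T)`, the transformation behaviour of a product of `M` theta
functions. -/
def QuasiPeriodic (c : R) (M : ℕ) (h : R[T;T⁻¹]⟦X⟧) : Prop :=
  IsShift h (PowerSeries.C (AddMonoidAlgebra.single (-(M : ℤ)) c : R[T;T⁻¹]) * h)

namespace QuasiPeriodic

variable {c d : R} {M N : ℕ} {g h : R[T;T⁻¹]⟦X⟧}

lemma mul (hg : QuasiPeriodic c M g) (hh : QuasiPeriodic d N h) :
    QuasiPeriodic (c * d) (M + N) (g * h) := by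
  have := IsShift.mul hg hh
  rw [mul_mul_mul_comm, ← map_mul, AddMonoidAlgebra.single_mul_single] at this
  rwa [QuasiPeriodic, Nat.cast_add, neg_add]

lemma map_C_mul (hh : QuasiPeriodic c M h) (f : R⟦X⟧) :
    QuasiPeriodic c M (f.map LaurentPolynomial.C * h) := by
  have := IsShift.mul (isShift_map_C f) hh
  rwa [mul_left_comm] at this

lemma sub (hg : QuasiPeriodic c M g) (hh : QuasiPeriodic c M h) : QuasiPeriodic c M (g - h) := by
  have := IsShift.sub hg hh
  rwa [← mul_sub] at this

lemma zero (c : R) (M : ℕ) : QuasiPeriodic c M 0 := by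
  intro k l
  simp [bicoeff]

lemma sum {ι : Type*} {s : Finset ι} {g : ι → R[T;T⁻¹]⟦X⟧}
    (h : ∀ i ∈ s, QuasiPeriodic c M (g i)) : QuasiPeriodic c M (∑ i ∈ s, g i) :=
  Finset.sum_induction _ _ (fun g h hg hh => by simpa using hg.sub ((zero c M).sub hh)) (zero c M) h

lemma bicoeff_eq (hh : QuasiPeriodic c M h) (k l : ℤ) :
    bicoeff h (k - l) l = c * bicoeff h k (l + M) := by
  rw [← hh k l]
  unfold bicoeff
  split_ifs
  · rw [PowerSeries.coeff_C_mul,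
      AddMonoidAlgebra.coeff_single_mul_eq_mul_coeff (l + M) fun m _ => by omega]
  · rw [mul_zero]

end QuasiPeriodic

lemma quasiPeriodic_thetaSeries (b : Rˣ) :
    QuasiPeriodic (-(b : R)) 1 (thetaSeries (unitTDiv b)) := by
  have := isShift_thetaSeries b
  rwa [coe_inv_unitTDiv, ← AddMonoidAlgebra.single_neg] at this

lemma quasiPeriodic_prod_thetaSeries {ι : Type*} (s : Finset ι) (b : ι → Rˣ) :
    QuasiPeriodic (∏ i ∈ s, (-(b i : R))) s.card (∏ i ∈ s, thetaSeries (unitTDiv (b i))) := by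
  classical
  induction s using Finset.induction_on with
  | empty => simpa [QuasiPeriodic] using isShift_one (R := R)
  | insert i s hi ih =>
    rw [Finset.prod_insert hi, Finset.prod_insert hi, Finset.card_insert_of_notMem hi, add_comm]
    exact (quasiPeriodic_thetaSeries (b i)).mul ih

/-- Evaluation of the coefficients of a power series at `T = z`. -/
noncomputable def evalT (z : Rˣ) : R[T;T⁻¹]⟦X⟧ →+* R⟦X⟧ :=
  PowerSeries.map (LaurentPolynomial.eval₂ (RingHom.id R) z)

lemma evalT_thetaSeries (z b : Rˣ) : evalT z (thetaSeries (unitTDiv b)) = thetaSeries (z / b) := by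
  rw [evalT, map_thetaSeries]
  congr 1
  ext
  change LaurentPolynomial.eval₂ (RingHom.id R) z (unitTDiv b : R[T;T⁻¹]) = _
  rw [coe_unitTDiv, LaurentPolynomial.single_eq_C_mul_T, LaurentPolynomial.eval₂_C_mul_T]
  simp [div_eq_mul_inv, mul_comm]

lemma evalT_map_C (z : Rˣ) (f : R⟦X⟧) : evalT z (f.map LaurentPolynomial.C) = f := by
  ext k
  simp [evalT]

end Shift

/-! ### Theta interpolation and partial fractions -/

section Interpolation

variable {A : Type*} [Field A] {ι : Type*}

lemma eq_C_mul_nodal {S : Finset ι} {v : ι → A} (hv : Set.InjOn v S) {P : Polynomial A}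
    (hdeg : P.natDegree ≤ S.card) (hP : ∀ i ∈ S, P.eval (v i) = 0) :
    P = Polynomial.C (P.coeff S.card) * Lagrange.nodal S v := by
  refine Polynomial.eq_of_degree_sub_lt_of_eval_index_eq S hv ?_ fun i hi => ?_
  · rw [Polynomial.degree_lt_iff_coeff_zero]
    intro m hm
    rw [Polynomial.coeff_sub, Polynomial.coeff_C_mul]
    rcases hm.eq_or_lt with rfl | hm
    · have hlead : (Lagrange.nodal S v).coeff S.card = 1 := by
        rw [← Lagrange.natDegree_nodal (s := S) (v := v)]
        exact Lagrange.nodal_monic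
      rw [hlead, mul_one, sub_self]
    · rw [Polynomial.coeff_eq_zero_of_natDegree_lt (hdeg.trans_lt hm),
        Polynomial.coeff_eq_zero_of_natDegree_lt (Lagrange.natDegree_nodal.trans_lt hm), mul_zero,
        sub_zero]
  · rw [hP i hi, Polynomial.eval_mul, Lagrange.eval_nodal_at_node hi, mul_zero]

lemma polynomial_eq_zero_of_eval {c : A} {S : Finset ι} {v : ι → A} (hv : Set.InjOn v S)
    {P : Polynomial A} (hdeg : P.natDegree ≤ S.card) (h0 : P.coeff 0 = c * P.coeff S.card)
    (hc : ∏ i ∈ S, (-v i) ≠ c) (hP : ∀ i ∈ S, P.eval (v i) = 0) : P = 0 := by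
  have hnodal := eq_C_mul_nodal hv hdeg hP
  have heval := congrArg (Polynomial.eval 0) hnodal
  simp only [Polynomial.eval_mul, Polynomial.eval_C, Lagrange.eval_nodal, zero_sub,
    ← Polynomial.coeff_zero_eq_eval_zero, h0] at heval
  have hzero : (c - ∏ i ∈ S, (-v i)) * P.coeff S.card = 0 := by linear_combination heval
  rw [hnodal, (mul_eq_zero.1 hzero).resolve_left (sub_ne_zero.2 hc.symm), map_zero, zero_mul]

lemma exists_toLaurent_eq {R : Type*} [Semiring R] {f : R[T;T⁻¹]} {M : ℕ}
    (hf : ∀ l : ℤ, f.coeff l ≠ 0 → 0 ≤ l ∧ l ≤ M) :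
    ∃ P : Polynomial R, Polynomial.toLaurent P = f ∧ P.natDegree ≤ M := by
  refine ⟨∑ l ∈ Finset.range (M + 1), Polynomial.monomial l (f.coeff l), ?_,
    Polynomial.natDegree_sum_le_of_forall_le _ _ fun l hl =>
      (Polynomial.natDegree_monomial_le _).trans (Nat.lt_succ_iff.1 (Finset.mem_range.1 hl))⟩
  ext l
  simp only [map_sum, AddMonoidAlgebra.coeff_sum, Finsupp.finsetSum_apply,
    Polynomial.toLaurent_C_mul_T, ← LaurentPolynomial.single_eq_C_mul_T,
    AddMonoidAlgebra.coeff_single]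
  by_cases hl : f.coeff l = 0
  · rw [hl]
    refine Finset.sum_eq_zero fun m _ => ?_
    rcases eq_or_ne (m : ℤ) l with rfl | hml
    · rw [Finsupp.single_eq_same, hl]
    · rw [Finsupp.single_eq_of_ne hml.symm]
  · obtain ⟨hl0, hlM⟩ := hf l hl
    lift l to ℕ using hl0
    rw [Finset.sum_eq_single l, Finsupp.single_eq_same]
    · exact fun m _ hml => Finsupp.single_eq_of_ne (Nat.cast_injective.ne hml.symm)
    · exact fun hmem => absurd (Finset.mem_range.2 (by omega)) hmem

lemma laurent_eq_zero_of_eval {c : A} {S : Finset ι} {a : ι → Aˣ} (ha : Set.InjOn a S)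
    {f : A[T;T⁻¹]} (hf : ∀ l : ℤ, f.coeff l ≠ 0 → 0 ≤ l ∧ l ≤ S.card)
    (h0 : f.coeff 0 = c * f.coeff S.card) (hc : ∏ i ∈ S, (-(a i : A)) ≠ c)
    (hev : ∀ i ∈ S, LaurentPolynomial.eval₂ (RingHom.id A) (a i) f = 0) : f = 0 := by
  obtain ⟨P, rfl, hdeg⟩ := exists_toLaurent_eq hf
  have hcoeff (l : ℕ) : (Polynomial.toLaurent P).coeff l = P.coeff l := by
    rw [LaurentPolynomial.coeff_toLaurent]
    exact Finsupp.mapDomain_apply Nat.cast_injective _ _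
  rw [polynomial_eq_zero_of_eval (v := fun i => (a i : A)) (Units.val_injective.comp_injOn ha)
    hdeg (by simpa only [← hcoeff, Nat.cast_zero] using h0) hc fun i hi => ?_, map_zero]
  rw [← hev i hi, LaurentPolynomial.eval₂_toLaurent]
  rfl

theorem QuasiPeriodic.eq_zero {c : A} {S : Finset ι} {h : A[T;T⁻¹]⟦X⟧}
    (hh : QuasiPeriodic c S.card h) (hS : S.Nonempty) {a : ι → Aˣ} (ha : Set.InjOn a S)
    (hc0 : c ≠ 0) (hc : ∏ i ∈ S, (-(a i : A)) ≠ c) (hev : ∀ i ∈ S, evalT (a i) h = 0) :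
    h = 0 := by
  ext1 k
  induction k using Nat.strong_induction_on with
  | _ k ih =>
    have hlow (k' : ℤ) (hk' : k' < k) (l : ℤ) : bicoeff h k' l = 0 := by
      rcases lt_or_ge k' 0 with hneg | hnonneg
      · exact bicoeff_of_neg _ hneg _
      · lift k' to ℕ using hnonneg
        rw [bicoeff_natCast, ih k' (by exact_mod_cast hk')]
        simp
    have := hS.card_pos
    rw [map_zero]
    refine laurent_eq_zero_of_eval (c := c) ha (fun l hl => ?_) ?_ hc fun i hi => ?_
    · rw [← bicoeff_natCast] at hl
      constructor <;> by_contra hcon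
      · have := hh.bicoeff_eq (k + l) l
        rw [add_sub_cancel_right, hlow (k + l) (by omega), mul_zero] at this
        exact hl this
      · have := hh.bicoeff_eq k (l - S.card)
        rw [sub_add_cancel, hlow _ (by omega)] at this
        exact hl ((mul_eq_zero.1 this.symm).resolve_left hc0)
    · have := hh.bicoeff_eq k 0
      rwa [sub_zero, zero_add, bicoeff_natCast, bicoeff_natCast] at this
    · simpa [evalT] using congrArg (PowerSeries.coeff k) (hev i hi)

lemma constantCoeff_thetaSeries_ne_zero {u : Aˣ} (hu : u ≠ 1) :
    PowerSeries.constantCoeff (thetaSeries u) ≠ 0 := by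
  rw [constantCoeff_thetaSeries, sub_ne_zero]
  exact fun h => hu (Units.ext h.symm)

variable [DecidableEq ι]

lemma constantCoeff_prod_thetaSeries_ne_zero {S : Finset ι} {a : ι → Aˣ} (ha : Set.InjOn a S)
    {i : ι} (hi : i ∈ S) :
    PowerSeries.constantCoeff (∏ j ∈ S.erase i, thetaSeries (a i / a j)) ≠ 0 := by
  rw [map_prod]
  refine Finset.prod_ne_zero_iff.2 fun j hj => constantCoeff_thetaSeries_ne_zero fun h => ?_
  rw [Finset.mem_erase] at hj
  exact hj.1 (ha hi hj.2 (div_eq_one.1 h)).symm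

lemma quasiPeriodic_interpolant {S : Finset ι} {a : ι → Aˣ} {c : A} {Q : Aˣ}
    (hQ : Q * c = ∏ i ∈ S, (-(a i : A))) {i : ι} (hi : i ∈ S) :
    QuasiPeriodic c S.card
      (thetaSeries (unitTDiv (a i / Q)) * ∏ j ∈ S.erase i, thetaSeries (unitTDiv (a j))) := by
  have := (quasiPeriodic_thetaSeries (a i / Q)).mul (quasiPeriodic_prod_thetaSeries (S.erase i) a)
  rw [Finset.card_erase_of_mem hi,
    add_tsub_cancel_of_le (Finset.one_le_card.2 ⟨i, hi⟩)] at this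
  convert this using 1
  rw [← Finset.mul_prod_erase S _ hi] at hQ
  rw [Units.val_div_eq_div_val]
  field_simp
  linear_combination hQ

/-- Both sides are quasi-periodic in `z` with the same multiplier, and they agree at the nodes. -/
theorem theta_interpolation {S : Finset ι} (hS : S.Nonempty) {a b : ι → Aˣ}
    (ha : Set.InjOn a S) {Q : Aˣ} (hQ : Q * ∏ i ∈ S, b i = ∏ i ∈ S, a i) (hQ1 : Q ≠ 1) (z : Aˣ) :
    thetaSeries Q * ∏ j ∈ S, thetaSeries (z / b j) =
      ∑ i ∈ S, ((∏ j ∈ S, thetaSeries (a i / b j)) * (∏ j ∈ S.erase i, thetaSeries (a i / a j))⁻¹) *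
        (thetaSeries (z / (a i / Q)) * ∏ j ∈ S.erase i, thetaSeries (z / a j)) := by
  set c : A := ∏ i ∈ S, (-(b i : A)) with hc
  have hQc : (Q : A) * c = ∏ i ∈ S, (-(a i : A)) := by
    have := congrArg Units.val hQ
    simp only [Units.val_mul, Units.coe_prod] at this
    rw [hc, Finset.prod_neg, Finset.prod_neg, mul_left_comm, this]
  have hc0 : c ≠ 0 := Finset.prod_ne_zero_iff.2 fun i _ => neg_ne_zero.2 (b i).ne_zero
  set w : ι → A⟦X⟧ := fun i =>
    (∏ j ∈ S, thetaSeries (a i / b j)) * (∏ j ∈ S.erase i, thetaSeries (a i / a j))⁻¹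
  set h : A[T;T⁻¹]⟦X⟧ :=
    (thetaSeries Q).map LaurentPolynomial.C * ∏ j ∈ S, thetaSeries (unitTDiv (b j)) -
      ∑ i ∈ S, (w i).map LaurentPolynomial.C *
        (thetaSeries (unitTDiv (a i / Q)) * ∏ j ∈ S.erase i, thetaSeries (unitTDiv (a j))) with hh
  have hev (z : Aˣ) : evalT z h = thetaSeries Q * ∏ j ∈ S, thetaSeries (z / b j) -
      ∑ i ∈ S, w i *
        (thetaSeries (z / (a i / Q)) * ∏ j ∈ S.erase i, thetaSeries (z / a j)) := by
    simp only [hh, map_sub, map_mul, map_sum, map_prod, evalT_map_C, evalT_thetaSeries]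
  have hqp : QuasiPeriodic c S.card h :=
    ((quasiPeriodic_prod_thetaSeries S b).map_C_mul _).sub
      (.sum fun i hi => (quasiPeriodic_interpolant hQc hi).map_C_mul _)
  have hnode (i : ι) (hi : i ∈ S) : evalT (a i) h = 0 := by
    rw [hev, Finset.sum_eq_single_of_mem i hi fun j _ hji => ?_, div_div_cancel]
    · linear_combination (-(thetaSeries Q * ∏ j ∈ S, thetaSeries (a i / b j))) *
        PowerSeries.inv_mul_cancel _ (constantCoeff_prod_thetaSeries_ne_zero ha hi)
    · rw [Finset.prod_eq_zero (Finset.mem_erase.2 ⟨hji.symm, hi⟩)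
        (by rw [div_self', thetaSeries_one]), mul_zero, mul_zero]
  have hmult : ∏ i ∈ S, (-(a i : A)) ≠ c := by
    rw [← hQc, Ne, mul_eq_right₀ hc0]
    exact fun h1 => hQ1 (Units.ext h1)
  rw [← sub_eq_zero, ← hev, hqp.eq_zero hS ha hc0 hmult hnode, map_zero]

end Interpolation

section FieldValued

variable {A F : Type*} [Field A] [Field F] {ι κ : Type*} (φ : A⟦X⟧ →+* F)

/-- The theta function with values in a field containing `A⟦X⟧`. -/
noncomputable def thetaVal (u : Aˣ) : F := φ (thetaSeries u)

lemma map_C_units_ne_zero (u : Aˣ) : φ (PowerSeries.C (u : A)) ≠ 0 :=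
  ((u.isUnit.map PowerSeries.C).map φ).ne_zero

lemma thetaVal_inv (u : Aˣ) :
    thetaVal φ u⁻¹ = -(φ (PowerSeries.C (u : A)))⁻¹ * thetaVal φ u := by
  rw [thetaVal, thetaSeries_inv, map_neg, map_mul, neg_mul, Units.val_inv_eq_inv_val]
  congr 2
  exact map_inv₀ (φ.comp PowerSeries.C) (u : A)

lemma thetaVal_div_comm (u v : Aˣ) :
    thetaVal φ (u / v) =
      -(φ (PowerSeries.C (u : A)) / φ (PowerSeries.C (v : A))) * thetaVal φ (v / u) := by
  rw [← inv_div v u, thetaVal_inv, ← inv_div (φ (PowerSeries.C (v : A))), Units.val_div_eq_div_val]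
  congr 3
  exact map_div₀ (φ.comp PowerSeries.C) (v : A) u

variable {φ}

lemma thetaVal_ne_zero (hφ : Function.Injective φ) {u : Aˣ} (hu : u ≠ 1) : thetaVal φ u ≠ 0 :=
  (map_ne_zero_iff φ hφ).2 fun h => constantCoeff_thetaSeries_ne_zero hu (by rw [h, map_zero])

lemma injOn_elim_div {K : Finset ι} {x : ι → Aˣ} {q : Aˣ} (hq : q ≠ 1)
    (hx : ∀ i ∈ K, ∀ j ∈ K, i ≠ j → x i ≠ x j ∧ x i ≠ x j / q) :
    Set.InjOn (Sum.elim x fun i => x i / q) (K.disjSum K) := by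
  have hself (i : ι) : x i ≠ x i / q := fun h => hq (div_eq_self.1 h.symm)
  rintro (i | i) hi (j | j) hj h <;>
    simp only [Finset.mem_coe, Finset.inl_mem_disjSum, Finset.inr_mem_disjSum] at hi hj <;>
    rcases eq_or_ne i j with rfl | hij
  · rfl
  · exact absurd h (hx i hi j hj hij).1
  · exact absurd h (hself i)
  · exact absurd h (hx i hi j hj hij).2
  · exact absurd h.symm (hself i)
  · exact absurd h.symm (hx j hj i hi hij.symm).2
  · rfl
  · exact absurd (div_left_injective h) (hx i hi j hj hij).1

variable [DecidableEq ι] [DecidableEq κ]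

lemma theta_interpolation_thetaVal {S : Finset ι} (hS : S.Nonempty) {a b : ι → Aˣ}
    (ha : Set.InjOn a S) {Q : Aˣ} (hQ : Q * ∏ i ∈ S, b i = ∏ i ∈ S, a i) (hQ1 : Q ≠ 1) (z : Aˣ) :
    thetaVal φ Q * ∏ j ∈ S, thetaVal φ (z / b j) =
      ∑ i ∈ S, (∏ j ∈ S, thetaVal φ (a i / b j)) / (∏ j ∈ S.erase i, thetaVal φ (a i / a j)) *
        (thetaVal φ (z / (a i / Q)) * ∏ j ∈ S.erase i, thetaVal φ (z / a j)) := by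
  simp only [thetaVal, ← map_prod, ← map_mul]
  rw [theta_interpolation hS ha hQ hQ1 z, map_sum]
  refine Finset.sum_congr rfl fun i hi => ?_
  rw [map_mul, map_mul φ (∏ j ∈ S, _), div_eq_mul_inv (φ _)]
  congr 2
  refine eq_inv_of_mul_eq_one_left ?_
  rw [← map_mul, PowerSeries.inv_mul_cancel _ (constantCoeff_prod_thetaSeries_ne_zero ha hi),
    map_one]

theorem sum_partial_fractions_thetaVal (hφ : Function.Injective φ) {S : Finset ι}
    {a b : ι → Aˣ} (ha : Set.InjOn a S) (hab : ∏ i ∈ S, a i = ∏ i ∈ S, b i)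
    (hne : ∃ i ∈ S, a i ≠ b i) :
    ∑ i ∈ S, (∏ j ∈ S, thetaVal φ (a i / b j)) / ∏ j ∈ S.erase i, thetaVal φ (a i / a j) = 0 := by
  obtain ⟨m, hm, hmne⟩ := hne
  obtain ⟨U, hmU, rfl⟩ : ∃ U, m ∉ U ∧ insert m U = S :=
    ⟨S.erase m, Finset.notMem_erase m S, Finset.insert_erase hm⟩
  rw [Finset.prod_insert hmU, Finset.prod_insert hmU] at hab
  have hU : U.Nonempty := by
    rw [Finset.nonempty_iff_ne_empty]
    rintro rfl
    exact hmne (by simpa using hab)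
  have hint := theta_interpolation_thetaVal (φ := φ) hU
    (ha.mono (Finset.coe_subset.2 (Finset.subset_insert m U))) (Q := b m / a m)
    (by rw [div_mul_eq_mul_div, ← hab, mul_div_cancel_left]) (div_ne_one.2 hmne.symm) (a m)
  have hthne {i j : ι} (hi : i ∈ insert m U) (hj : j ∈ insert m U) (hij : i ≠ j) :
      thetaVal φ (a i / a j) ≠ 0 :=
    thetaVal_ne_zero hφ (div_ne_one.2 (ha.ne hi hj hij))
  have hW : ∏ j ∈ U, thetaVal φ (a m / a j) ≠ 0 := Finset.prod_ne_zero_iff.2 fun j hj =>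
    hthne hm (Finset.mem_insert_of_mem hj) (ne_of_mem_of_not_mem hj hmU).symm
  have hκ (u : Aˣ) := map_C_units_ne_zero φ u
  set c := φ (PowerSeries.C (b m : A)) / φ (PowerSeries.C (a m : A)) *
    ∏ j ∈ U, thetaVal φ (a m / a j)
  have hc : c ≠ 0 := mul_ne_zero (div_ne_zero (hκ _) (hκ _)) hW
  rw [Finset.sum_insert hmU, Finset.erase_insert hmU, Finset.prod_insert hmU,
    ← eq_neg_iff_add_eq_zero, ← mul_right_inj' (neg_ne_zero.2 hc), neg_mul_neg, Finset.mul_sum]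
  trans thetaVal φ (b m / a m) * ∏ j ∈ U, thetaVal φ (a m / b j)
  · rw [thetaVal_div_comm φ (b m)]
    simp only [c]
    field_simp
  rw [hint]
  refine Finset.sum_congr rfl fun i hi => ?_
  have him : i ≠ m := ne_of_mem_of_not_mem hi hmU
  have hi' := Finset.mem_insert_of_mem (b := m) hi
  have hmi : thetaVal φ (a i / a m) ≠ 0 := hthne hi' hm him
  have hκai := hκ (a i)
  rw [show a m / (a i / (b m / a m)) = b m / a i by rw [div_div_eq_mul_div, mul_div_cancel],
    Finset.erase_insert_of_ne him.symm, Finset.prod_insert hmU,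
    Finset.prod_insert fun h => hmU (Finset.mem_of_mem_erase h), thetaVal_div_comm φ (b m)]
  simp only [c]
  rw [← Finset.mul_prod_erase U (fun j => thetaVal φ (a m / a j)) hi, thetaVal_div_comm φ (a m)]
  have hκam := hκ (a m)
  field_simp

lemma prod_thetaVal_div_eq {K : Finset ι} (x : ι → Aˣ) (q t : Aˣ) {i : ι} (hi : i ∈ K) :
    ((∏ j ∈ K, thetaVal φ (t * (x i / x j))) * ∏ j ∈ K, thetaVal φ (q / t * (x i / x j))) /
        ((∏ j ∈ K.erase i, thetaVal φ (x i / x j)) * ∏ j ∈ K, thetaVal φ (q * (x i / x j))) =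
      thetaVal φ t * thetaVal φ (q / t) / thetaVal φ q *
        ∏ j ∈ K.erase i, (thetaVal φ (t * (x i / x j)) * thetaVal φ (q / t * (x i / x j))) /
          (thetaVal φ (x i / x j) * thetaVal φ (q * (x i / x j))) := by
  rw [Finset.prod_div_distrib, Finset.prod_mul_distrib, Finset.prod_mul_distrib,
    ← Finset.mul_prod_erase K (fun j => thetaVal φ (t * (x i / x j))) hi,
    ← Finset.mul_prod_erase K (fun j => thetaVal φ (q / t * (x i / x j))) hi,
    ← Finset.mul_prod_erase K (fun j => thetaVal φ (q * (x i / x j))) hi, div_self', mul_one,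
    mul_one, mul_one, div_mul_div_comm]
  ring

lemma thetaVal_inv_mul_thetaVal_inv_div (q t : Aˣ) :
    thetaVal φ t⁻¹ * thetaVal φ (q⁻¹ / t⁻¹) / thetaVal φ q⁻¹ =
      -(thetaVal φ t * thetaVal φ (q / t) / thetaVal φ q) := by
  have hq := map_C_units_ne_zero φ q
  have ht := map_C_units_ne_zero φ t
  rw [inv_div_inv, thetaVal_inv, thetaVal_inv φ q, thetaVal_div_comm φ t q]
  field_simp

lemma disjSum_erase_inl (K : Finset ι) (L : Finset κ) (i : ι) :
    (K.disjSum L).erase (Sum.inl i) = (K.erase i).disjSum L := by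
  ext (j | j) <;> simp

lemma disjSum_erase_inr (K : Finset ι) (L : Finset κ) (i : κ) :
    (K.disjSum L).erase (Sum.inr i) = K.disjSum (L.erase i) := by
  ext (j | j) <;> simp

/-- The partial fractions with nodes `x i`, `x i / q` and zeros `x i / t`, `t * x i / q`. -/
lemma sum_partial_fractions_doubled (hφ : Function.Injective φ) {K : Finset ι}
    {x : ι → Aˣ} {q t : Aˣ} (hq : q ≠ 1) (ht : t ≠ 1)
    (hx : ∀ i ∈ K, ∀ j ∈ K, i ≠ j → x i ≠ x j ∧ x i ≠ x j / q) :
    ∑ i ∈ K,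
        ((∏ j ∈ K, thetaVal φ (t * (x i / x j))) * ∏ j ∈ K, thetaVal φ (q / t * (x i / x j))) /
        ((∏ j ∈ K.erase i, thetaVal φ (x i / x j)) * ∏ j ∈ K, thetaVal φ (q * (x i / x j))) +
      ∑ i ∈ K,
        ((∏ j ∈ K, thetaVal φ (t⁻¹ * (x i / x j))) *
          ∏ j ∈ K, thetaVal φ (q⁻¹ / t⁻¹ * (x i / x j))) /
        ((∏ j ∈ K.erase i, thetaVal φ (x i / x j)) * ∏ j ∈ K, thetaVal φ (q⁻¹ * (x i / x j))) =
      0 := by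
  rcases K.eq_empty_or_nonempty with rfl | ⟨i₀, hi₀⟩
  · simp
  let b : ι ⊕ ι → Aˣ := Sum.elim (fun i => x i / t) fun i => t * x i / q
  have hab : ∏ i ∈ K.disjSum K, Sum.elim x (fun i => x i / q) i = ∏ i ∈ K.disjSum K, b i := by
    rw [Finset.prod_disjSum, Finset.prod_disjSum, ← Finset.prod_mul_distrib,
      ← Finset.prod_mul_distrib]
    refine Finset.prod_congr rfl fun i _ => ?_
    simp only [b, Sum.elim_inl, Sum.elim_inr]
    rw [mul_div_assoc, ← mul_assoc, div_mul_cancel]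
  have hpartial := sum_partial_fractions_thetaVal hφ (injOn_elim_div hq hx) hab
    ⟨Sum.inl i₀, Finset.inl_mem_disjSum.2 hi₀, fun h => ht (div_eq_self.1 h.symm)⟩
  have hquot (i j : ι) :
      x i / (x j / t) = t * (x i / x j) ∧ x i / (t * x j / q) = q / t * (x i / x j) ∧
      x i / (x j / q) = q * (x i / x j) ∧ x i / q / (x j / t) = q⁻¹ / t⁻¹ * (x i / x j) ∧
      x i / q / (t * x j / q) = t⁻¹ * (x i / x j) ∧ x i / q / x j = q⁻¹ * (x i / x j) ∧
      x i / q / (x j / q) = x i / x j := by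
    refine ⟨?_, ?_, ?_, ?_, ?_, ?_, ?_⟩ <;> apply Units.ext <;>
      simp only [Units.val_mul, Units.val_div_eq_div_val, Units.val_inv_eq_inv_val] <;> field_simp
  simp only [Finset.sum_disjSum, Finset.prod_disjSum, disjSum_erase_inl, disjSum_erase_inr, b,
    Sum.elim_inl, Sum.elim_inr, hquot] at hpartial
  simpa only [mul_comm] using hpartial

lemma sum_prod_thetaVal_eq (hφ : Function.Injective φ) {K : Finset ι}
    {x : ι → Aˣ} {q t : Aˣ} (hq : q ≠ 1) (ht : t ≠ 1) (htq : t ≠ q)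
    (hx : ∀ i ∈ K, ∀ j ∈ K, i ≠ j → x i ≠ x j ∧ x i ≠ x j / q) :
    ∑ i ∈ K, ∏ j ∈ K.erase i, (thetaVal φ (t * (x i / x j)) * thetaVal φ (q / t * (x i / x j))) /
        (thetaVal φ (x i / x j) * thetaVal φ (q * (x i / x j))) =
      ∑ i ∈ K, ∏ j ∈ K.erase i,
        (thetaVal φ (t⁻¹ * (x i / x j)) * thetaVal φ (q⁻¹ / t⁻¹ * (x i / x j))) /
        (thetaVal φ (x i / x j) * thetaVal φ (q⁻¹ * (x i / x j))) := by
  have hdoubled := sum_partial_fractions_doubled hφ hq ht hx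
  rw [Finset.sum_congr rfl fun i hi => prod_thetaVal_div_eq x q t hi,
    Finset.sum_congr rfl fun i hi => prod_thetaVal_div_eq x q⁻¹ t⁻¹ hi,
    ← Finset.mul_sum, ← Finset.mul_sum, thetaVal_inv_mul_thetaVal_inv_div, neg_mul,
    add_neg_eq_zero] at hdoubled
  exact mul_left_cancel₀ (div_ne_zero (mul_ne_zero (thetaVal_ne_zero hφ ht)
    (thetaVal_ne_zero hφ (div_ne_one.2 htq.symm))) (thetaVal_ne_zero hφ hq)) hdoubled

end FieldValued

/-! ### The coefficients of the operators as products over ordered pairs -/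

section Coefficients

variable {n : ℕ}

/-- The monomial `∏_{k ∈ S} z_k`. -/
noncomputable def prodX (S : Finset (Fin n)) : AsympSeries n := ∏ k ∈ S, MvPowerSeries.X k

lemma prodX_mul_compl (S : Finset (Fin n)) : prodX S * prodX Sᶜ = nome n :=
  Finset.prod_mul_prod_compl S _

lemma prodX_ne_zero (S : Finset (Fin n)) : prodX S ≠ 0 :=
  Finset.prod_ne_zero_iff.2 fun k _ h => by
    have := congrArg (MvPowerSeries.coeff (Finsupp.single k 1)) h
    simp at this

lemma nome_ne_zero : nome n ≠ 0 := prodX_ne_zero Finset.univ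

lemma constantCoeff_prodX {S : Finset (Fin n)} (hS : S.Nonempty) :
    MvPowerSeries.constantCoeff (prodX S) = 0 := by
  obtain ⟨k, hk⟩ := hS
  rw [prodX, map_prod, Finset.prod_eq_zero hk (MvPowerSeries.constantCoeff_X k)]

/-- The cyclic interval `(i, j]`, for `i ≠ j`: the indices of the variables whose product is
`x_j / x_i`, or `p x_j / x_i` if `j < i`. -/
def cyclicIoc (i j : Fin n) : Finset (Fin n) :=
  if i < j then Finset.Ioc i j else (Finset.Ioc j i)ᶜ

lemma mem_cyclicIoc {i j k : Fin n} :
    k ∈ cyclicIoc i j ↔ if i < j then i < k ∧ k ≤ j else ¬(j < k ∧ k ≤ i) := by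
  unfold cyclicIoc; split_ifs <;> simp

lemma coeff_nome_pow_mul {β : Fin n →₀ ℕ} {m : Fin n} {N : ℕ} (h : β m < N)
    (f : AsympSeries n) : MvPowerSeries.coeff β (nome n ^ N * f) = 0 := by
  refine (MvPowerSeries.X_pow_dvd_iff (s := m)).1 ?_ β h
  exact (pow_dvd_pow_of_dvd (Finset.dvd_prod_of_mem _ (Finset.mem_univ m)) N).mul_right f

lemma coeff_prod_nome_stable {β : Fin n →₀ ℕ} {m : Fin n} {N M : ℕ} (h : β m < N) (hM : N ≤ M)
    (a : AsympSeries n) :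
    MvPowerSeries.coeff β (∏ i ∈ Finset.range M, (1 - nome n ^ i * a)) =
      MvPowerSeries.coeff β (∏ i ∈ Finset.range N, (1 - nome n ^ i * a)) := by
  induction M, hM using Nat.le_induction with
  | base => rfl
  | succ M hM ih =>
    rw [Finset.prod_range_succ, mul_sub, mul_one, map_sub, ih, mul_left_comm,
      coeff_nome_pow_mul (h.trans_le hM), sub_zero]

lemma coeff_pochhammer {β : Fin n →₀ ℕ} {m : Fin n} {N : ℕ} (h : β m < N) (a : AsympSeries n) :
    MvPowerSeries.coeff β (pochhammer a) =
      MvPowerSeries.coeff β (∏ i ∈ Finset.range N, (1 - nome n ^ i * a)) := by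
  change MvPowerSeries.coeff β (∏ i ∈ Finset.range (β.degree + 1), (1 - nome n ^ i * a)) = _
  have h' : β m < β.degree + 1 := Nat.lt_succ_of_le (Finsupp.le_degree m β)
  rcases le_total N (β.degree + 1) with hN | hN
  · exact coeff_prod_nome_stable h hN a
  · exact (coeff_prod_nome_stable h' hN a).symm

lemma constantCoeff_pochhammer (a : AsympSeries n) (ha : MvPowerSeries.constantCoeff a = 0) :
    MvPowerSeries.constantCoeff (pochhammer a) = 1 := by
  rw [← MvPowerSeries.coeff_zero_eq_constantCoeff_apply]
  change MvPowerSeries.coeff 0 (∏ i ∈ Finset.range ((0 : Fin n →₀ ℕ).degree + 1), _) = _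
  simp [ha]

lemma map_pochhammer (σ : AsympSeries n →+* AsympSeries n) (w : (Fin n →₀ ℕ) → ℂ)
    (e : (Fin n →₀ ℕ) → (Fin n →₀ ℕ)) (hdeg : ∀ β, (e β).degree = β.degree)
    (hσ : ∀ f β, MvPowerSeries.coeff β (σ f) = w β * MvPowerSeries.coeff (e β) f)
    (hnome : σ (nome n) = nome n) (a : AsympSeries n) :
    σ (pochhammer a) = pochhammer (σ a) := by
  ext β
  rw [hσ]
  change w β * MvPowerSeries.coeff (e β) (∏ i ∈ Finset.range ((e β).degree + 1), _) =
    MvPowerSeries.coeff β (∏ i ∈ Finset.range (β.degree + 1), _)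
  rw [← hσ, hdeg, map_prod]
  simp only [map_sub, map_one, map_mul, map_pow, hnome]

/-- `θ(c x_i / x_j)` up to a monomial factor, for `i ≠ j`. -/
noncomputable def thetaPair (c : ℂ) (i j : Fin n) : AsympSeries n :=
  pochhammer (MvPowerSeries.C c⁻¹ * prodX (cyclicIoc i j)) *
    pochhammer (MvPowerSeries.C c * prodX (cyclicIoc j i))

lemma thetaPair_inv (c : ℂ) (i j : Fin n) : thetaPair c⁻¹ i j = thetaPair c j i := by
  rw [thetaPair, thetaPair, inv_inv, mul_comm]

lemma theta_eq_thetaPair (c : ℂ) {i j : Fin n} (h : i < j) : theta c i j = thetaPair c j i := by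
  rw [theta, thetaPair, mul_comm]
  simp only [cyclicIoc, if_pos h, if_neg h.asymm]
  rfl

lemma cyclicIoc_nonempty (i j : Fin n) : (cyclicIoc i j).Nonempty := by
  refine ⟨j, ?_⟩
  rw [mem_cyclicIoc]
  split_ifs with h1
  · exact ⟨h1, le_rfl⟩
  · simp

lemma constantCoeff_thetaPair (c : ℂ) (i j : Fin n) :
    MvPowerSeries.constantCoeff (thetaPair c i j) = 1 := by
  rw [thetaPair, map_mul, constantCoeff_pochhammer, constantCoeff_pochhammer, mul_one]
  · rw [map_mul, constantCoeff_prodX (cyclicIoc_nonempty j i), mul_zero]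
  · rw [map_mul, constantCoeff_prodX (cyclicIoc_nonempty i j), mul_zero]

/-- The quotient of `θ(c x_i / x_j)` by `θ(d x_i / x_j)`, up to a monomial factor; for `c = t` and
`d = 1` this is the factor of `opCoeff t I` belonging to `i ∈ I` and `j ∉ I`. -/
noncomputable def pairCoeff (c d : ℂ) (i j : Fin n) : AsympSeries n :=
  thetaPair c i j * (thetaPair d i j)⁻¹

lemma theta_inv_mul_inv_eq_pairCoeff (t : ℂ) {i j : Fin n} (h : i < j) :
    theta t⁻¹ i j * (theta 1 i j)⁻¹ = pairCoeff t 1 i j := by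
  rw [theta_eq_thetaPair _ h, theta_eq_thetaPair _ h, thetaPair_inv, ← thetaPair_inv 1 i j, inv_one,
    pairCoeff]

lemma theta_mul_inv_eq_pairCoeff (t : ℂ) {i j : Fin n} (h : i < j) :
    theta t i j * (theta 1 i j)⁻¹ = pairCoeff t 1 j i := by
  rw [theta_eq_thetaPair _ h, theta_eq_thetaPair _ h, pairCoeff]

lemma opCoeff_eq (t : ℂ) (I : Finset (Fin n)) :
    opCoeff t I = ∏ i ∈ I, ∏ j ∈ Iᶜ, pairCoeff t 1 i j := by
  have hlt : (∏ i ∈ I, ∏ j ∈ Iᶜ with i < j, theta t⁻¹ i j * (theta 1 i j)⁻¹) =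
      ∏ i ∈ I, ∏ j ∈ Iᶜ with i < j, pairCoeff t 1 i j :=
    Finset.prod_congr rfl fun i _ => Finset.prod_congr rfl fun j hj =>
      theta_inv_mul_inv_eq_pairCoeff t (Finset.mem_filter.1 hj).2
  have hgt : (∏ j ∈ Iᶜ, ∏ i ∈ I with j < i, theta t j i * (theta 1 j i)⁻¹) =
      ∏ i ∈ I, ∏ j ∈ Iᶜ with ¬ i < j, pairCoeff t 1 i j := by
    simp only [Finset.prod_filter]
    rw [Finset.prod_comm]
    refine Finset.prod_congr rfl fun i hi => Finset.prod_congr rfl fun j hj => ?_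
    have hne : j ≠ i := fun h => Finset.mem_compl.1 hj (h ▸ hi)
    simp only [not_lt, hne.le_iff_lt]
    exact ite_congr rfl (theta_mul_inv_eq_pairCoeff t) fun _ => rfl
  rw [opCoeff, hlt, hgt, ← Finset.prod_mul_distrib]
  exact Finset.prod_congr rfl fun i _ => Finset.prod_filter_mul_prod_filter_not _ _ _

variable [NeZero n]

lemma val_add_one_eq (k : Fin n) : (k + 1).val = if k.val + 1 = n then 0 else k.val + 1 := by
  have := k.isLt
  rw [Fin.val_add, Fin.val_one', Nat.add_mod_mod]
  split_ifs with h
  · rw [h, Nat.mod_self]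
  · exact Nat.mod_eq_of_lt (by omega)

lemma add_one_mem_cyclicIoc_add_one {i j k : Fin n} (h : i ≠ j) :
    k + 1 ∈ cyclicIoc (i + 1) (j + 1) ↔ k ∈ cyclicIoc i j := by
  have := Fin.val_ne_of_ne h
  have := i.isLt
  have := j.isLt
  have := k.isLt
  simp only [mem_cyclicIoc, Fin.lt_def, Fin.le_def, val_add_one_eq]
  split_ifs <;> omega

lemma indicator_cyclicIoc_sub {i j : Fin n} (h : i ≠ j) (k : Fin n) :
    (if k ∈ cyclicIoc i j then (1 : ℤ) else 0) - (if k + 1 ∈ cyclicIoc i j then 1 else 0) =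
      (if k = j then 1 else 0) - (if k = i then 1 else 0) := by
  have := Fin.val_ne_of_ne h
  have := i.isLt
  have := j.isLt
  have := k.isLt
  simp only [mem_cyclicIoc, Fin.lt_def, Fin.le_def, val_add_one_eq, Fin.ext_iff]
  split_ifs <;> omega

end Coefficients

/-! ### Expansion in powers of the nome -/

section NomeExpansion

variable {n : ℕ}

lemma prodX_eq_monomial (S : Finset (Fin n)) :
    prodX S = MvPowerSeries.monomial (∑ k ∈ S, Finsupp.single k 1) (1 : ℂ) := by
  simp only [prodX, MvPowerSeries.X_def, MvPowerSeries.prod_monomial, Finset.prod_const_one]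

/-- The field of fractions of `AsympSeries n`. -/
abbrev AsympField (n : ℕ) : Type := FractionRing (AsympSeries n)

lemma algebraMap_nome_ne_zero :
    algebraMap (AsympSeries n) (AsympField n) (nome n) ≠ 0 := by
  rw [Ne, IsFractionRing.to_map_eq_zero_iff]
  exact nome_ne_zero

lemma algebraMap_prodX_ne_zero (S : Finset (Fin n)) :
    algebraMap (AsympSeries n) (AsympField n) (prodX S) ≠ 0 := by
  rw [Ne, IsFractionRing.to_map_eq_zero_iff]
  exact prodX_ne_zero S

/-- Nonzero constants as units of the field of fractions. -/
noncomputable def constUnit (n : ℕ) : ℂˣ →* (AsympField n)ˣ :=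
  Units.map ((algebraMap (AsympSeries n) (AsympField n)).comp MvPowerSeries.C).toMonoidHom

lemma constUnit_val (c : ℂˣ) : (constUnit n c : AsympField n) =
    algebraMap (AsympSeries n) (AsympField n) (MvPowerSeries.C (c : ℂ)) := rfl

variable [NeZero n]

/-- The part of `f` of degree `k` in `z₀`. -/
def slice (k : ℕ) (f : AsympSeries n) : AsympSeries n := fun β : Fin n →₀ ℕ =>
  if β 0 = k then MvPowerSeries.coeff β f else 0

lemma coeff_slice (k : ℕ) (f : AsympSeries n) (β : Fin n →₀ ℕ) :
    MvPowerSeries.coeff β (slice k f) = if β 0 = k then MvPowerSeries.coeff β f else 0 := rfl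

lemma slice_mul (k : ℕ) (f g : AsympSeries n) :
    slice k (f * g) = ∑ x ∈ Finset.HasAntidiagonal.antidiagonal k, slice x.1 f * slice x.2 g := by
  classical
  ext β
  rw [coeff_slice, map_sum]
  simp only [MvPowerSeries.coeff_mul, coeff_slice, ite_zero_mul_ite_zero]
  rw [Finset.sum_comm]
  split_ifs with h
  · refine Finset.sum_congr rfl fun y hy => ?_
    have hy' := Finset.HasAntidiagonal.mem_antidiagonal.1 hy
    rw [Finset.sum_eq_single (y.1 0, y.2 0)]
    · simp
    · intro x _ hx
      rw [if_neg]
      rintro ⟨h1, h2⟩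
      exact hx (Prod.ext h1.symm h2.symm)
    · intro hx
      exfalso
      apply hx
      rw [Finset.HasAntidiagonal.mem_antidiagonal, ← h, ← hy', Finsupp.add_apply]
  · symm
    refine Finset.sum_eq_zero fun y hy => Finset.sum_eq_zero fun x hx => ?_
    rw [if_neg]
    rintro ⟨h1, h2⟩
    apply h
    have hy' := Finset.HasAntidiagonal.mem_antidiagonal.1 hy
    have hx' := Finset.HasAntidiagonal.mem_antidiagonal.1 hx
    rw [← hy', Finsupp.add_apply, h1, h2, ← hx']

lemma slice_eq_ite {f : AsympSeries n} {k : ℕ}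
    (hf : ∀ β, MvPowerSeries.coeff β f ≠ 0 → β 0 = k) (j : ℕ) :
    slice j f = if j = k then f else 0 := by
  ext β
  rw [coeff_slice]
  by_cases hβ : MvPowerSeries.coeff β f = 0
  · split_ifs <;> simp [hβ]
  · simp only [hf β hβ, eq_comm (a := k)]
    split_ifs <;> simp

lemma slice_one (k : ℕ) : slice k (1 : AsympSeries n) = if k = 0 then 1 else 0 := by
  classical
  refine slice_eq_ite (fun β hβ => ?_) k
  rw [MvPowerSeries.coeff_one, ne_eq, ite_eq_right_iff, not_forall] at hβ
  rw [hβ.1, Finsupp.coe_zero, Pi.zero_apply]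

lemma slice_zero (k : ℕ) : slice k (0 : AsympSeries n) = 0 := by
  ext β
  simp [coeff_slice]

lemma slice_add (k : ℕ) (f g : AsympSeries n) : slice k (f + g) = slice k f + slice k g := by
  ext β
  simp only [coeff_slice, map_add]
  split_ifs <;> simp

/-- The expansion in powers of the nome `X`: `z₀` is replaced by `X / (z₁ ⋯ zₙ₋₁)`. -/
noncomputable def nomeExpansion (n : ℕ) [NeZero n] :
    AsympSeries n →+* (AsympField n)⟦X⟧ where
  toFun f := PowerSeries.mk fun k =>
    algebraMap (AsympSeries n) (AsympField n) (slice k f) /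
      algebraMap (AsympSeries n) (AsympField n) (nome n) ^ k
  map_one' := by
    ext k
    rw [PowerSeries.coeff_mk, PowerSeries.coeff_one, slice_one]
    split_ifs with hk <;> simp [hk]
  map_zero' := by
    ext k
    simp [slice_zero]
  map_add' f g := by
    ext k
    simp [slice_add, add_div]
  map_mul' f g := by
    ext k
    rw [PowerSeries.coeff_mk, PowerSeries.coeff_mul, slice_mul, map_sum, Finset.sum_div]
    refine Finset.sum_congr rfl fun x hx => ?_
    rw [PowerSeries.coeff_mk, PowerSeries.coeff_mk, map_mul,
      ← Finset.HasAntidiagonal.mem_antidiagonal.1 hx, pow_add, mul_div_mul_comm]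

lemma coeff_nomeExpansion (f : AsympSeries n) (k : ℕ) :
    PowerSeries.coeff k (nomeExpansion n f) =
      algebraMap (AsympSeries n) (AsympField n) (slice k f) /
        algebraMap (AsympSeries n) (AsympField n) (nome n) ^ k :=
  PowerSeries.coeff_mk k fun k => algebraMap (AsympSeries n) (AsympField n) (slice k f) /
      algebraMap (AsympSeries n) (AsympField n) (nome n) ^ k

lemma nomeExpansion_injective : Function.Injective (nomeExpansion n) := by
  rw [injective_iff_map_eq_zero]
  intro f hf
  ext β
  have h := congrArg (PowerSeries.coeff (β 0)) hf
  rw [coeff_nomeExpansion, (PowerSeries.coeff (R := AsympField n) _).map_zero, div_eq_zero_iff,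
    or_iff_left (pow_ne_zero _ algebraMap_nome_ne_zero), IsFractionRing.to_map_eq_zero_iff] at h
  have h' := congrArg (MvPowerSeries.coeff β) h
  rwa [coeff_slice, if_pos rfl] at h'

lemma nomeExpansion_eq_C_mul_X_pow {f : AsympSeries n} {k : ℕ}
    (hf : ∀ β, MvPowerSeries.coeff β f ≠ 0 → β 0 = k) :
    nomeExpansion n f = PowerSeries.C (algebraMap (AsympSeries n) (AsympField n) f /
        algebraMap (AsympSeries n) (AsympField n) (nome n) ^ k) * PowerSeries.X ^ k := by
  ext j
  rw [coeff_nomeExpansion, PowerSeries.coeff_C_mul, PowerSeries.coeff_X_pow]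
  rw [slice_eq_ite hf]
  split_ifs with h
  · rw [h, mul_one]
  · simp

lemma nomeExpansion_C_mul_prodX (c : ℂ) (S : Finset (Fin n)) :
    nomeExpansion n (MvPowerSeries.C c * prodX S) =
      PowerSeries.C (algebraMap (AsympSeries n) (AsympField n) (MvPowerSeries.C c * prodX S) /
        algebraMap (AsympSeries n) (AsympField n) (nome n) ^ (if (0 : Fin n) ∈ S then 1 else 0)) *
          PowerSeries.X ^ (if (0 : Fin n) ∈ S then 1 else 0) := by
  classical
  refine nomeExpansion_eq_C_mul_X_pow fun β hβ => ?_
  rw [MvPowerSeries.coeff_C_mul, prodX_eq_monomial, MvPowerSeries.coeff_monomial] at hβ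
  have hβ' : β = ∑ k ∈ S, Finsupp.single k 1 := by
    by_contra h
    simp [h] at hβ
  rw [hβ', Finsupp.finsetSum_apply]
  simp [Finsupp.single_apply]

/-- The coordinate `x_i` (with `x_1 = 1`) in the field of fractions. -/
noncomputable def coord (i : Fin n) : (AsympField n)ˣ :=
  Units.mk0 (algebraMap (AsympSeries n) (AsympField n) (prodX (Finset.Ioc 0 i)))
    (algebraMap_prodX_ne_zero _)

lemma coord_mul {i j : Fin n} (h : i ≤ j) :
    (coord j : AsympField n) =
      coord i * algebraMap (AsympSeries n) (AsympField n) (prodX (Finset.Ioc i j)) := by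
  simp only [coord, Units.val_mk0, prodX]
  rw [← map_mul, ← Finset.prod_union]
  · rw [Finset.Ioc_union_Ioc_eq_Ioc (Fin.zero_le i) h]
  · rw [Finset.disjoint_left]
    intro k hk hk'
    exact absurd (Finset.mem_Ioc.1 hk).2 (not_le.2 (Finset.mem_Ioc.1 hk').1)

lemma nomeExpansion_cyclicIoc (c : ℂˣ) {i j : Fin n} (h : i ≠ j) :
    nomeExpansion n (MvPowerSeries.C (c : ℂ) * prodX (cyclicIoc i j)) =
      PowerSeries.C (↑(constUnit n c * (coord j / coord i)) : AsympField n) *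
        PowerSeries.X ^ (if i < j then 0 else 1) := by
  rw [nomeExpansion_C_mul_prodX, map_mul, Units.val_mul, Units.val_div_eq_div_val, constUnit_val]
  have hi := (coord i).ne_zero
  have hj := (coord j).ne_zero
  by_cases hij : i < j
  · have h0 : (0 : Fin n) ∉ cyclicIoc i j := by
      rw [mem_cyclicIoc, if_pos hij]
      exact fun h => absurd h.1 (not_lt.2 (Fin.zero_le _))
    rw [if_neg h0, if_pos hij, pow_zero, div_one, coord_mul hij.le, cyclicIoc, if_pos hij,
      mul_div_cancel_left₀ _ hi]
  · have hji : j < i := lt_of_le_of_ne (not_lt.1 hij) h.symm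
    have h0 : (0 : Fin n) ∈ cyclicIoc i j := by
      rw [mem_cyclicIoc, if_neg hij]
      exact fun h => absurd h.1 (not_lt.2 (Fin.zero_le _))
    have hS := algebraMap_prodX_ne_zero (Finset.Ioc j i)
    have hS' := algebraMap_prodX_ne_zero (Finset.Ioc j i)ᶜ
    rw [if_pos h0, if_neg hij, pow_one, coord_mul hji.le, cyclicIoc, if_neg hij,
      ← prodX_mul_compl (Finset.Ioc j i), map_mul]
    congr 2
    field_simp

lemma coeff_nomeExpansion_congr {f g : AsympSeries n} {k : ℕ}
    (h : ∀ β : Fin n →₀ ℕ, β 0 = k → MvPowerSeries.coeff β f = MvPowerSeries.coeff β g) :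
    PowerSeries.coeff k (nomeExpansion n f) = PowerSeries.coeff k (nomeExpansion n g) := by
  have : slice k f = slice k g := by
    ext β
    rw [coeff_slice, coeff_slice]
    split_ifs with hβ
    · exact h β hβ
    · rfl
  rw [coeff_nomeExpansion, coeff_nomeExpansion, this]

lemma nomeExpansion_nome : nomeExpansion n (nome n) = PowerSeries.X := by
  have h := nomeExpansion_C_mul_prodX 1 (Finset.univ : Finset (Fin n))
  rw [map_one, one_mul, if_pos (Finset.mem_univ _), pow_one, pow_one,
    show prodX (Finset.univ : Finset (Fin n)) = nome n from rfl,
    div_self algebraMap_nome_ne_zero, map_one, one_mul] at h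
  exact h

lemma coeff_nomeExpansion_pochhammer (a : AsympSeries n) {k N : ℕ} (h : k < N) :
    PowerSeries.coeff k (nomeExpansion n (pochhammer a)) =
      PowerSeries.coeff k (∏ i ∈ Finset.range N, (1 - PowerSeries.X ^ i * nomeExpansion n a)) := by
  rw [coeff_nomeExpansion_congr (g := ∏ i ∈ Finset.range N, (1 - nome n ^ i * a))
    fun β hβ => coeff_pochhammer (m := 0) (by omega) a, map_prod]
  simp only [map_sub, map_one, map_mul, map_pow, nomeExpansion_nome]

lemma nomeExpansion_pochhammer_of_C {a : AsympSeries n} {w : AsympField n}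
    (ha : nomeExpansion n a = PowerSeries.C w) :
    nomeExpansion n (pochhammer a) = (1 - PowerSeries.C w) * eulerProd w := by
  ext k
  rw [coeff_nomeExpansion_pochhammer a (Nat.lt_succ_self (k + 1)).le, Finset.prod_range_succ',
    pow_zero, one_mul, ha, mul_comm]
  refine coeff_mul_congr (k := k) (fun _ _ => rfl) (fun j hj => ?_) k le_rfl
  rw [coeff_eulerProd w (hj.trans k.le_succ), eulerPartial]
  simp only [mul_comm]

lemma nomeExpansion_pochhammer_of_C_mul_X {a : AsympSeries n} {w : AsympField n}
    (ha : nomeExpansion n a = PowerSeries.C w * PowerSeries.X) :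
    nomeExpansion n (pochhammer a) = eulerProd w := by
  ext k
  rw [coeff_nomeExpansion_pochhammer a (Nat.lt_succ_self k), ha, coeff_eulerProd w k.le_succ,
    eulerPartial]
  simp only [pow_succ, mul_left_comm]

/-- The unit `c x_i / x_j`. -/
noncomputable def ratioUnit (c : ℂˣ) (i j : Fin n) : (AsympField n)ˣ :=
  constUnit n c * (coord i / coord j)

lemma ratioUnit_inv (c : ℂˣ) (i j : Fin n) : (ratioUnit c i j)⁻¹ = ratioUnit c⁻¹ j i := by
  rw [ratioUnit, ratioUnit, mul_inv, inv_div, map_inv]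

lemma nomeExpansion_thetaPair (c : ℂˣ) {i j : Fin n} (h : i ≠ j) :
    nomeExpansion n (thetaPair (c : ℂ) i j) =
      if i < j then thetaSeries (ratioUnit c i j)⁻¹ else thetaSeries (ratioUnit c i j) := by
  rw [thetaPair, map_mul, ← Units.val_inv_eq_inv_val]
  have hij : nomeExpansion n (MvPowerSeries.C (↑c⁻¹ : ℂ) * prodX (cyclicIoc i j)) =
      PowerSeries.C (↑(ratioUnit c i j)⁻¹ : AsympField n) *
        PowerSeries.X ^ (if i < j then 0 else 1) := by
    rw [nomeExpansion_cyclicIoc c⁻¹ h, ratioUnit_inv, ratioUnit]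
  have hji : nomeExpansion n (MvPowerSeries.C (c : ℂ) * prodX (cyclicIoc j i)) =
      PowerSeries.C (↑(ratioUnit c i j) : AsympField n) *
        PowerSeries.X ^ (if j < i then 0 else 1) :=
    nomeExpansion_cyclicIoc c h.symm
  split_ifs with hlt
  · rw [if_pos hlt, pow_zero, mul_one] at hij
    rw [if_neg hlt.asymm, pow_one] at hji
    rw [nomeExpansion_pochhammer_of_C hij, nomeExpansion_pochhammer_of_C_mul_X hji, thetaSeries,
      inv_inv]
  · rw [if_neg hlt, pow_one] at hij
    rw [if_pos (lt_of_le_of_ne (not_lt.1 hlt) h.symm), pow_zero, mul_one] at hji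
    rw [nomeExpansion_pochhammer_of_C hji, nomeExpansion_pochhammer_of_C_mul_X hij, thetaSeries]
    ring

lemma coord_ne_const_mul (c : ℂˣ) {i j : Fin n} (h : i ≠ j) :
    coord i ≠ constUnit n c * coord j := by
  have coord_ne_of_lt (c : ℂˣ) {i j : Fin n} (hij : i < j) : coord j ≠ constUnit n c * coord i := by
    intro heq
    have hfield := congrArg Units.val heq
    rw [coord_mul hij.le, Units.val_mul, mul_comm, constUnit_val] at hfield
    have hseries : prodX (Finset.Ioc i j) = MvPowerSeries.C (c : ℂ) :=
      IsFractionRing.injective (AsympSeries n) (AsympField n)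
        (mul_right_cancel₀ (coord i).ne_zero hfield)
    have hconst := congrArg MvPowerSeries.constantCoeff hseries
    rw [constantCoeff_prodX ⟨j, Finset.mem_Ioc.2 ⟨hij, le_rfl⟩⟩,
      MvPowerSeries.constantCoeff_C] at hconst
    exact c.ne_zero hconst.symm
  rcases lt_or_gt_of_ne h with hij | hij
  · intro heq
    refine coord_ne_of_lt c⁻¹ hij ?_
    rw [heq, map_inv, inv_mul_cancel_left]
  · exact coord_ne_of_lt c hij

end NomeExpansion

/-! ### The `q`-shifts and their action on the coefficients -/

section Shift

lemma prod_zpow_eq_zpow_sum {ι G₀ : Type*} [CommGroupWithZero G₀] {q : G₀} (hq : q ≠ 0)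
    (s : Finset ι) (f : ι → ℤ) : ∏ i ∈ s, q ^ f i = q ^ ∑ i ∈ s, f i := by
  classical
  induction s using Finset.induction_on with
  | empty => simp
  | insert i s hi ih => rw [Finset.prod_insert hi, Finset.sum_insert hi, zpow_add₀ hq, ih]

lemma prod_compl_singleton {ι M : Type*} [Fintype ι] [DecidableEq ι] [CommMonoid M] {i : ι}
    {J : Finset ι} (hi : i ∈ J) (g : ι → M) :
    ∏ k ∈ {i}ᶜ, g k = (∏ k ∈ J.erase i, g k) * ∏ k ∈ Jᶜ, g k := by
  have hdisj : Disjoint (J.erase i) Jᶜ :=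
    Finset.disjoint_of_subset_left (Finset.erase_subset i J) disjoint_compl_right
  rw [← Finset.prod_union hdisj]
  congr 1
  ext k
  rw [Finset.mem_compl, Finset.mem_singleton, Finset.mem_union, Finset.mem_erase, Finset.mem_compl]
  grind

lemma prod_erase_prod_compl_erase {ι M : Type*} [Fintype ι] [DecidableEq ι] [CommMonoid M] {i : ι}
    {K : Finset ι} (hi : i ∈ K) (g : ι → ι → M) :
    ∏ j ∈ K.erase i, ∏ k ∈ (K.erase i)ᶜ, g j k =
      (∏ j ∈ K.erase i, g j i) * ∏ j ∈ K.erase i, ∏ k ∈ Kᶜ, g j k := by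
  rw [← Finset.prod_mul_distrib, Finset.compl_erase]
  exact Finset.prod_congr rfl fun j _ =>
    Finset.prod_insert fun h => Finset.mem_compl.1 h hi

variable {n : ℕ}

/-- The indicator function of a set of indices. -/
def ind (I : Finset (Fin n)) (i : Fin n) : ℤ := if i ∈ I then 1 else 0

/-- The pair factor with both arguments multiplied by `q ^ e`. -/
noncomputable def pairShift (q t : ℂ) (e : ℤ) (i j : Fin n) : AsympSeries n :=
  pairCoeff (t * q ^ e) (q ^ e) i j

lemma opCoeff_eq_pairShift (q t : ℂ) (I : Finset (Fin n)) :
    opCoeff t I = ∏ i ∈ I, ∏ j ∈ Iᶜ, pairShift q t 0 i j := by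
  rw [opCoeff_eq]
  simp [pairShift]

variable [NeZero n]

/-- The exponent of `x_i` in the monomial `z ^ β`. -/
def expo (β : Fin n →₀ ℕ) (i : Fin n) : ℤ := (β i : ℤ) - (β (i + 1) : ℤ)

/-- The shift `x_i ↦ q ^ (M i) x_i`. -/
noncomputable def shiftHom (q : ℂ) (M : Fin n → ℤ) : AsympSeries n →+* AsympSeries n :=
  MvPowerSeries.rescale fun k => q ^ (M k - M (k - 1))

lemma shiftHom_X (q : ℂ) (M : Fin n → ℤ) (k : Fin n) :
    shiftHom q M (MvPowerSeries.X k) =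
      (MvPowerSeries.C (q ^ (M k - M (k - 1))) * MvPowerSeries.X k : AsympSeries n) := by
  classical
  ext β
  rw [shiftHom, MvPowerSeries.coeff_rescale, MvPowerSeries.coeff_C_mul, MvPowerSeries.coeff_X]
  split_ifs with h
  · simp only [h, Finsupp.prod_single_index, pow_zero, pow_one]
  · rw [mul_zero, mul_zero]

lemma shiftHom_C (q : ℂ) (M : Fin n → ℤ) (c : ℂ) :
    shiftHom q M (MvPowerSeries.C c) = (MvPowerSeries.C c : AsympSeries n) := by
  classical
  ext β
  rw [shiftHom, MvPowerSeries.coeff_rescale, MvPowerSeries.coeff_C]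
  split_ifs with h
  · rw [h, Finsupp.prod_zero_index, one_mul]
  · rw [mul_zero]

lemma sum_mul_sub_add_one (M N : Fin n → ℤ) :
    ∑ i, M i * (N i - N (i + 1)) = ∑ k, (M k - M (k - 1)) * N k := by
  simp only [mul_sub, sub_mul, Finset.sum_sub_distrib]
  congr 1
  rw [← Equiv.sum_comp (Equiv.addRight (1 : Fin n)) fun k => M (k - 1) * N k]
  simp

variable {q : ℂ}

lemma coeff_shiftHom (hq : q ≠ 0) (M : Fin n → ℤ) (f : AsympSeries n) (β : Fin n →₀ ℕ) :
    MvPowerSeries.coeff β (shiftHom q M f) =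
      q ^ (∑ i, M i * expo β i) * MvPowerSeries.coeff β f := by
  rw [shiftHom, MvPowerSeries.coeff_rescale, Finsupp.prod_fintype _ _ (by simp)]
  simp only [← zpow_natCast, ← zpow_mul]
  rw [prod_zpow_eq_zpow_sum hq, ← sum_mul_sub_add_one M fun k => (β k : ℤ)]
  rfl

lemma shiftHom_shiftHom (hq : q ≠ 0) (M N : Fin n → ℤ) (f : AsympSeries n) :
    shiftHom q M (shiftHom q N f) = shiftHom q (M + N) f := by
  ext β
  rw [coeff_shiftHom hq, coeff_shiftHom hq, coeff_shiftHom hq, ← mul_assoc, ← zpow_add₀ hq,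
    ← Finset.sum_add_distrib]
  simp only [Pi.add_apply, add_mul]

lemma qShift_eq (hq : q ≠ 0) (I : Finset (Fin n)) (f : AsympSeries n) :
    qShift q I f = shiftHom q (ind I) f := by
  ext β
  rw [coeff_shiftHom hq]
  change (∏ i ∈ I, q ^ expo β i) * _ = _
  rw [prod_zpow_eq_zpow_sum hq]
  simp [ind]

lemma shiftHom_prodX (hq : q ≠ 0) (M : Fin n → ℤ) (S : Finset (Fin n)) :
    shiftHom q M (prodX S) =
      MvPowerSeries.C (q ^ (∑ i, M i * (ind S i - ind S (i + 1)))) * prodX S := by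
  rw [prodX, map_prod, Finset.prod_congr rfl fun k _ => shiftHom_X q M k,
    Finset.prod_mul_distrib, ← map_prod, prod_zpow_eq_zpow_sum hq, sum_mul_sub_add_one]
  simp [ind]

lemma shiftHom_nome (hq : q ≠ 0) (M : Fin n → ℤ) : shiftHom q M (nome n) = nome n := by
  have := shiftHom_prodX hq M (Finset.univ : Finset (Fin n))
  simpa [ind, prodX, nome] using this

lemma shiftHom_cyclicIoc (hq : q ≠ 0) (M : Fin n → ℤ) {i j : Fin n} (h : i ≠ j) :
    shiftHom q M (prodX (cyclicIoc i j)) =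
      MvPowerSeries.C (q ^ (M j - M i)) * prodX (cyclicIoc i j) := by
  rw [shiftHom_prodX hq]
  congr 3
  simp only [ind]
  rw [Finset.sum_congr rfl fun k _ => by rw [indicator_cyclicIoc_sub h k]]
  simp [mul_sub]

lemma shiftHom_pochhammer (hq : q ≠ 0) (M : Fin n → ℤ) (a : AsympSeries n) :
    shiftHom q M (pochhammer a) = pochhammer (shiftHom q M a) :=
  map_pochhammer _ _ id (fun _ => rfl) (fun f β => coeff_shiftHom hq M f β) (shiftHom_nome hq M) a

lemma shiftHom_thetaPair (hq : q ≠ 0) (M : Fin n → ℤ) (c : ℂ) {i j : Fin n} (h : i ≠ j) :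
    shiftHom q M (thetaPair c i j) = thetaPair (c * q ^ (M i - M j)) i j := by
  rw [thetaPair, map_mul, shiftHom_pochhammer hq, shiftHom_pochhammer hq, map_mul, map_mul,
    shiftHom_cyclicIoc hq M h, shiftHom_cyclicIoc hq M h.symm, shiftHom_C q, shiftHom_C q,
    thetaPair, ← mul_assoc, ← mul_assoc, ← map_mul, ← map_mul, mul_inv, ← zpow_neg, neg_sub]

lemma shiftHom_inv (hq : q ≠ 0) (M : Fin n → ℤ) {f : AsympSeries n}
    (hf : MvPowerSeries.constantCoeff f = 1) : shiftHom q M f⁻¹ = (shiftHom q M f)⁻¹ := by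
  have h0 : MvPowerSeries.constantCoeff (shiftHom q M f) ≠ 0 := by
    rw [← MvPowerSeries.coeff_zero_eq_constantCoeff_apply, coeff_shiftHom hq,
      MvPowerSeries.coeff_zero_eq_constantCoeff_apply, hf]
    simp [expo]
  rw [MvPowerSeries.eq_inv_iff_mul_eq_one h0, ← map_mul,
    MvPowerSeries.inv_mul_cancel _ (by rw [hf]; exact one_ne_zero), map_one]

lemma shiftHom_pairShift (hq : q ≠ 0) (M : Fin n → ℤ) (t : ℂ) (e : ℤ) {i j : Fin n} (h : i ≠ j) :
    shiftHom q M (pairShift q t e i j) = pairShift q t (e + (M i - M j)) i j := by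
  rw [pairShift, pairCoeff, map_mul, shiftHom_inv hq M (constantCoeff_thetaPair _ _ _),
    shiftHom_thetaPair hq M _ h, shiftHom_thetaPair hq M _ h, pairShift, pairCoeff, zpow_add₀ hq,
    mul_assoc]

lemma shiftHom_opCoeff (hq : q ≠ 0) (M : Fin n → ℤ) (t : ℂ) (I : Finset (Fin n)) :
    shiftHom q M (opCoeff t I) = ∏ i ∈ I, ∏ j ∈ Iᶜ, pairShift q t (M i - M j) i j := by
  rw [opCoeff_eq_pairShift q, map_prod]
  refine Finset.prod_congr rfl fun i hi => ?_
  rw [map_prod]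
  refine Finset.prod_congr rfl fun j hj => ?_
  have hij : i ≠ j := fun h => Finset.mem_compl.1 hj (h ▸ hi)
  rw [shiftHom_pairShift hq M t 0 hij, zero_add]

lemma opCoeff_singleton_mul_of_mem (hq : q ≠ 0) (t : ℂ) {i : Fin n} {J : Finset (Fin n)}
    (hi : i ∈ J) :
    opCoeff t {i} * shiftHom q (ind {i}) (opCoeff t J) =
      opCoeff t J * shiftHom q (ind J) (opCoeff t {i}) := by
  rw [shiftHom_opCoeff hq, shiftHom_opCoeff hq, opCoeff_eq_pairShift q t {i},
    opCoeff_eq_pairShift q t J, Finset.prod_singleton, Finset.prod_singleton,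
    prod_compl_singleton hi, prod_compl_singleton hi, ← Finset.mul_prod_erase J _ hi,
    ← Finset.mul_prod_erase J _ hi]
  have unshifted_away : ∏ j ∈ J.erase i, ∏ k ∈ Jᶜ, pairShift q t (ind {i} j - ind {i} k) j k =
      ∏ j ∈ J.erase i, ∏ k ∈ Jᶜ, pairShift q t 0 j k := by
    refine Finset.prod_congr rfl fun j hj => Finset.prod_congr rfl fun k hk => ?_
    have hji : j ≠ i := Finset.ne_of_mem_erase hj
    have hki : k ≠ i := fun h => Finset.mem_compl.1 hk (h ▸ hi)
    simp [ind, hji, hki]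
  have shifts_agree : ∏ k ∈ Jᶜ, pairShift q t (ind {i} i - ind {i} k) i k =
      ∏ k ∈ Jᶜ, pairShift q t (ind J i - ind J k) i k := by
    refine Finset.prod_congr rfl fun k hk => ?_
    have hkJ := Finset.mem_compl.1 hk
    have hki : k ≠ i := fun h => hkJ (h ▸ hi)
    simp [ind, hki, hkJ, hi]
  have unshifted_inside : ∏ k ∈ J.erase i, pairShift q t (ind J i - ind J k) i k =
      ∏ k ∈ J.erase i, pairShift q t 0 i k := by
    refine Finset.prod_congr rfl fun k hk => ?_
    simp [ind, hi, Finset.mem_of_mem_erase hk]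
  rw [unshifted_away, shifts_agree, unshifted_inside]
  ring

lemma opCoeff_singleton_mul_erase (hq : q ≠ 0) (t : ℂ) {i : Fin n} {K : Finset (Fin n)}
    (hi : i ∈ K) :
    opCoeff t {i} * shiftHom q (ind {i}) (opCoeff t (K.erase i)) =
      (∏ j ∈ K, ∏ k ∈ Kᶜ, pairShift q t 0 j k) *
        ∏ j ∈ K.erase i, (pairShift q t 0 i j * pairShift q t (-1) j i) := by
  rw [shiftHom_opCoeff hq, opCoeff_eq_pairShift q t {i}, Finset.prod_singleton,
    prod_compl_singleton hi, ← Finset.mul_prod_erase K _ hi, prod_erase_prod_compl_erase hi]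
  have shifted_at : ∏ j ∈ K.erase i, pairShift q t (ind {i} j - ind {i} i) j i =
      ∏ j ∈ K.erase i, pairShift q t (-1) j i := by
    refine Finset.prod_congr rfl fun j hj => ?_
    simp [ind, Finset.ne_of_mem_erase hj]
  have unshifted_away : ∏ j ∈ K.erase i, ∏ k ∈ Kᶜ, pairShift q t (ind {i} j - ind {i} k) j k =
      ∏ j ∈ K.erase i, ∏ k ∈ Kᶜ, pairShift q t 0 j k := by
    refine Finset.prod_congr rfl fun j hj => Finset.prod_congr rfl fun k hk => ?_
    have hki : k ≠ i := fun h => Finset.mem_compl.1 hk (h ▸ hi)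
    simp [ind, Finset.ne_of_mem_erase hj, hki]
  rw [shifted_at, unshifted_away, Finset.prod_mul_distrib]
  ring

lemma opCoeff_erase_mul_singleton (hq : q ≠ 0) (t : ℂ) {i : Fin n} {K : Finset (Fin n)}
    (hi : i ∈ K) :
    opCoeff t (K.erase i) * shiftHom q (ind (K.erase i)) (opCoeff t {i}) =
      (∏ j ∈ K, ∏ k ∈ Kᶜ, pairShift q t 0 j k) *
        ∏ j ∈ K.erase i, (pairShift q t 0 j i * pairShift q t (-1) i j) := by
  rw [shiftHom_opCoeff hq, opCoeff_eq_pairShift q t (K.erase i), Finset.prod_singleton,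
    prod_compl_singleton hi, ← Finset.mul_prod_erase K _ hi, prod_erase_prod_compl_erase hi]
  have shifted_inside :
      ∏ k ∈ K.erase i, pairShift q t (ind (K.erase i) i - ind (K.erase i) k) i k =
        ∏ k ∈ K.erase i, pairShift q t (-1) i k := by
    refine Finset.prod_congr rfl fun k hk => ?_
    simp only [ind, hk, if_true, Finset.notMem_erase, if_false, zero_sub]
  have unshifted_outside :
      ∏ k ∈ Kᶜ, pairShift q t (ind (K.erase i) i - ind (K.erase i) k) i k =
        ∏ k ∈ Kᶜ, pairShift q t 0 i k := by
    refine Finset.prod_congr rfl fun k hk => ?_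
    simp [ind, Finset.mem_compl.1 hk]
  rw [shifted_inside, unshifted_outside, Finset.prod_mul_distrib]
  ring

end Shift

/-! ### Commutation with the operator of order one -/

section PairIdentity

variable {n : ℕ}

lemma pairCoeff_swap (c d : ℂ) (i j : Fin n) : pairCoeff c d j i = pairCoeff c⁻¹ d⁻¹ i j := by
  rw [pairCoeff, pairCoeff, thetaPair_inv, thetaPair_inv]

lemma pairCoeff_mul_pairCoeff (c d e : ℂ) (i j : Fin n) :
    pairCoeff c d i j * pairCoeff d e i j = pairCoeff c e i j := by
  have hd : MvPowerSeries.constantCoeff (thetaPair d i j) ≠ 0 :=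
    constantCoeff_thetaPair d i j ▸ one_ne_zero
  rw [pairCoeff, mul_assoc, pairCoeff, ← mul_assoc (thetaPair d i j)⁻¹,
    MvPowerSeries.inv_mul_cancel _ hd, one_mul, pairCoeff]

lemma pairCoeff_self (c : ℂ) (i j : Fin n) : pairCoeff c c i j = 1 :=
  MvPowerSeries.mul_inv_cancel _ (constantCoeff_thetaPair c i j ▸ one_ne_zero)

lemma pairShift_swap (q t : ℂ) (e : ℤ) (i j : Fin n) :
    pairShift q t e j i = pairShift q⁻¹ t⁻¹ e i j := by
  rw [pairShift, pairCoeff_swap, mul_inv, ← inv_zpow, pairShift]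

lemma pairShift_mul_pairShift_swap (q t : ℂ) (i j : Fin n) :
    pairShift q t 0 i j * pairShift q t (-1) j i = pairCoeff t 1 i j * pairCoeff (q / t) q i j := by
  rw [pairShift, pairShift, pairCoeff_swap _ _ i j, zpow_zero, mul_one, zpow_neg_one, mul_inv,
    inv_inv, mul_comm t⁻¹, div_eq_mul_inv]

lemma pairShift_mul_pairShift_swap_eq_one {q t : ℂ} (hq : q ≠ 0) (h : t = 1 ∨ t = q)
    (i j : Fin n) : pairShift q t 0 i j * pairShift q t (-1) j i = 1 := by
  rw [pairShift_mul_pairShift_swap]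
  rcases h with rfl | rfl
  · rw [div_one, pairCoeff_self, pairCoeff_self, one_mul]
  · rw [div_self hq, pairCoeff_mul_pairCoeff, pairCoeff_self]

lemma constUnit_injective : Function.Injective (constUnit n) := fun _ _ hcd =>
  Units.ext (MvPowerSeries.C_injective (IsFractionRing.injective (AsympSeries n) (AsympField n)
    (congrArg Units.val hcd)))

variable [NeZero n]

/-- The expansion in powers of the nome, with values in a field. -/
noncomputable def nomeField (n : ℕ) [NeZero n] :
    AsympSeries n →+* FractionRing (PowerSeries (AsympField n)) :=
  (algebraMap _ _).comp (nomeExpansion n)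

lemma nomeField_injective : Function.Injective (nomeField n) :=
  (IsFractionRing.injective _ _).comp nomeExpansion_injective

/-- The theta function with values in the field of `nomeField`. -/
noncomputable def fieldTheta (u : (AsympField n)ˣ) : FractionRing (PowerSeries (AsympField n)) :=
  thetaVal (algebraMap (PowerSeries (AsympField n)) _) u

lemma nomeField_thetaPair (c : ℂˣ) {i j : Fin n} (h : i ≠ j) :
    nomeField n (thetaPair (c : ℂ) i j) =
      if i < j then fieldTheta (ratioUnit c i j)⁻¹ else fieldTheta (ratioUnit c i j) := by
  rw [nomeField, RingHom.comp_apply, nomeExpansion_thetaPair c h]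
  split_ifs <;> rfl

lemma nomeField_pairCoeff (c d : ℂ) (i j : Fin n) :
    nomeField n (pairCoeff c d i j) =
      nomeField n (thetaPair c i j) / nomeField n (thetaPair d i j) := by
  rw [pairCoeff, map_mul, div_eq_mul_inv]
  congr 1
  refine eq_inv_of_mul_eq_one_left ?_
  rw [← map_mul, MvPowerSeries.inv_mul_cancel _ (constantCoeff_thetaPair d i j ▸ one_ne_zero),
    map_one]

/- Each factor `θ(u⁻¹)` differs from `θ(u)` by the monomial `-u⁻¹`; these monomials cancel in the
quotient because the arguments on top and below have the same product. -/
lemma nomeField_pairCoeff_mul {c₁ c₂ d₁ d₂ : ℂˣ} (hcd : c₁ * c₂ = d₁ * d₂) {i j : Fin n}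
    (h : i ≠ j) :
    nomeField n (pairCoeff (c₁ : ℂ) d₁ i j * pairCoeff (c₂ : ℂ) d₂ i j) =
      fieldTheta (ratioUnit c₁ i j) * fieldTheta (ratioUnit c₂ i j) /
        (fieldTheta (ratioUnit d₁ i j) * fieldTheta (ratioUnit d₂ i j)) := by
  rw [map_mul, nomeField_pairCoeff, nomeField_pairCoeff, div_mul_div_comm]
  simp only [nomeField_thetaPair _ h]
  split_ifs
  · let monom (u : (AsympField n)ˣ) : FractionRing (PowerSeries (AsympField n)) :=
      algebraMap (PowerSeries (AsympField n)) _ (PowerSeries.C (u : AsympField n))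
    have hinv (u : (AsympField n)ˣ) : fieldTheta u⁻¹ = -(monom u)⁻¹ * fieldTheta u :=
      thetaVal_inv _ u
    have hne (u : (AsympField n)ˣ) : monom u ≠ 0 := map_C_units_ne_zero _ u
    have hmonom : monom (ratioUnit c₁ i j) * monom (ratioUnit c₂ i j) =
        monom (ratioUnit d₁ i j) * monom (ratioUnit d₂ i j) := by
      simp only [monom, ← map_mul, ← Units.val_mul, ratioUnit]
      rw [mul_mul_mul_comm, mul_mul_mul_comm (constUnit n d₁), ← map_mul, ← map_mul, hcd]
    rw [hinv, hinv, hinv, hinv, mul_mul_mul_comm, mul_mul_mul_comm (-(monom (ratioUnit d₁ i j))⁻¹),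
      neg_mul_neg, neg_mul_neg, ← mul_inv, ← mul_inv, hmonom,
      mul_div_mul_left _ _ (inv_ne_zero (mul_ne_zero (hne _) (hne _)))]
  · rfl

lemma nomeField_pairShift_mul_pairShift_swap (q t : ℂˣ) {i j : Fin n} (h : i ≠ j) :
    nomeField n (pairShift (q : ℂ) t 0 i j * pairShift (q : ℂ) t (-1) j i) =
      fieldTheta (ratioUnit t i j) * fieldTheta (ratioUnit (q / t) i j) /
        (fieldTheta (ratioUnit 1 i j) * fieldTheta (ratioUnit q i j)) := by
  have hcd : t * (q / t) = 1 * q := by rw [mul_div_cancel, one_mul]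
  rw [pairShift_mul_pairShift_swap, ← nomeField_pairCoeff_mul hcd h, Units.val_one,
    Units.val_div_eq_div_val]

lemma sum_prod_pairShift {q t : ℂ} (hq : q ≠ 0) (hq1 : q ≠ 1) (ht : t ≠ 0)
    (K : Finset (Fin n)) :
    ∑ i ∈ K, ∏ j ∈ K.erase i, (pairShift q t 0 i j * pairShift q t (-1) j i) =
      ∑ i ∈ K, ∏ j ∈ K.erase i, (pairShift q t 0 j i * pairShift q t (-1) i j) := by
  have hswap (i j : Fin n) : pairShift q t 0 j i * pairShift q t (-1) i j =
      pairShift q⁻¹ t⁻¹ 0 i j * pairShift q⁻¹ t⁻¹ (-1) j i := by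
    rw [pairShift_swap, pairShift_swap q t (-1) j i]
  rw [Finset.sum_congr rfl fun i _ => Finset.prod_congr rfl fun j _ => hswap i j]
  by_cases htriv : t = 1 ∨ t = q
  · have htriv' : t⁻¹ = 1 ∨ t⁻¹ = q⁻¹ := htriv.imp inv_eq_one.2 (congrArg _)
    simp only [pairShift_mul_pairShift_swap_eq_one hq htriv,
      pairShift_mul_pairShift_swap_eq_one (inv_ne_zero hq) htriv']
  push Not at htriv
  apply nomeField_injective
  lift q to ℂˣ using hq.isUnit
  lift t to ℂˣ using ht.isUnit
  simp only [map_sum, map_prod, ← Units.val_inv_eq_inv_val]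
  have hval (q t : ℂˣ) : ∑ i ∈ K, ∏ j ∈ K.erase i,
      nomeField n (pairShift (q : ℂ) t 0 i j * pairShift (q : ℂ) t (-1) j i) =
        ∑ i ∈ K, ∏ j ∈ K.erase i,
          fieldTheta (ratioUnit t i j) * fieldTheta (ratioUnit (q / t) i j) /
            (fieldTheta (ratioUnit 1 i j) * fieldTheta (ratioUnit q i j)) :=
    Finset.sum_congr rfl fun i _ => Finset.prod_congr rfl fun j hj =>
      nomeField_pairShift_mul_pairShift_swap q t (Finset.ne_of_mem_erase hj).symm
  have hne {c d : ℂˣ} (h : (c : ℂ) ≠ d) : constUnit n c ≠ constUnit n d :=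
    fun h' => h (congrArg Units.val (constUnit_injective h'))
  have hcoord (i : Fin n) (_ : i ∈ K) (j : Fin n) (_ : j ∈ K) (hij : i ≠ j) :
      coord i ≠ coord j ∧ coord i ≠ coord j / constUnit n q :=
    ⟨by simpa using coord_ne_const_mul 1 hij, by
      simpa [inv_mul_eq_div] using coord_ne_const_mul q⁻¹ hij⟩
  have hfield := sum_prod_thetaVal_eq
    (φ := algebraMap (PowerSeries (AsympField n)) (FractionRing (PowerSeries (AsympField n))))
    (IsFractionRing.injective _ _) (map_one (constUnit n) ▸ hne hq1)
    (map_one (constUnit n) ▸ hne htriv.1) (hne htriv.2) hcoord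
  rw [hval, hval]
  simpa only [fieldTheta, ratioUnit, map_one, one_mul, map_div, map_inv] using hfield

end PairIdentity

section Commutation

variable {n : ℕ}

/-- The weights `s^I` of the `r`-th operator. -/
def weight (s : Fin n → ℂ) (r : ℕ) (I : Finset (Fin n)) : ℂ :=
  if I.card = r then ∏ i ∈ I, s i else 0

lemma sum_powersetCard_insert {ι M : Type*} [Fintype ι] [DecidableEq ι] [AddCommMonoid M] (r : ℕ)
    (F : ι → Finset ι → M) :
    ∑ i, ∑ J ∈ (Finset.univ : Finset ι).powersetCard r with i ∉ J, F i J =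
      ∑ K ∈ (Finset.univ : Finset ι).powersetCard (r + 1), ∑ i ∈ K, F i (K.erase i) := by
  rw [Finset.sum_sigma', Finset.sum_sigma']
  refine Finset.sum_bij' (fun x _ => ⟨insert x.1 x.2, x.1⟩) (fun y _ => ⟨y.2, y.1.erase y.2⟩)
    ?_ ?_ ?_ ?_ ?_
  · rintro ⟨i, J⟩ h
    simp only [Finset.mem_sigma, Finset.mem_univ, true_and, Finset.mem_filter,
      Finset.mem_powersetCard, Finset.subset_univ] at h ⊢
    exact ⟨by rw [Finset.card_insert_of_notMem h.2, h.1], Finset.mem_insert_self _ _⟩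
  · rintro ⟨K, i⟩ h
    simp only [Finset.mem_sigma, Finset.mem_univ, true_and, Finset.mem_filter,
      Finset.mem_powersetCard, Finset.subset_univ] at h ⊢
    exact ⟨by rw [Finset.card_erase_of_mem h.2, h.1]; rfl, Finset.notMem_erase _ _⟩
  · rintro ⟨i, J⟩ h
    simp only [Finset.mem_sigma, Finset.mem_univ, true_and, Finset.mem_filter] at h
    simp [Finset.erase_insert h.2]
  · rintro ⟨K, i⟩ h
    simp only [Finset.mem_sigma] at h
    simp [Finset.insert_erase h.2]
  · rintro ⟨i, J⟩ h
    simp only [Finset.mem_sigma, Finset.mem_univ, true_and, Finset.mem_filter] at h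
    simp [Finset.erase_insert h.2]

lemma ind_singleton_add_erase {i : Fin n} {K : Finset (Fin n)} (hi : i ∈ K) :
    ind {i} + ind (K.erase i) = ind K := by
  funext j
  by_cases hj : j = i
  · simp [ind, hj, hi]
  · simp [ind, hj]

variable [NeZero n]

/-- The operator `∑_I w_I 𝓑_I T^I` with arbitrary weights. -/
noncomputable def weightedOp (q t : ℂ) (w : Finset (Fin n) → ℂ) :
    AsympSeries n →ₗ[ℂ] AsympSeries n where
  toFun f := ∑ I, MvPowerSeries.C (w I) * opCoeff t I * shiftHom q (ind I) f
  map_add' f g := by simp only [map_add, mul_add, Finset.sum_add_distrib]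
  map_smul' c f := by
    simp only [MvPowerSeries.smul_eq_C_mul, map_mul, RingHom.id_apply, Finset.mul_sum, shiftHom_C]
    exact Finset.sum_congr rfl fun I _ => mul_left_comm _ _ _

lemma weightedOp_apply (q t : ℂ) (w : Finset (Fin n) → ℂ) (f : AsympSeries n) :
    weightedOp q t w f = ∑ I, MvPowerSeries.C (w I) * opCoeff t I * shiftHom q (ind I) f := rfl

variable {q : ℂ}

lemma modifiedOp_eq_sum (hq : q ≠ 0) (t : ℂ) (s : Fin n → ℂ) (r : ℕ) (f : AsympSeries n) :
    modifiedOp q t s r f = ∑ I ∈ (Finset.univ : Finset (Fin n)).powersetCard r,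
      MvPowerSeries.C (∏ i ∈ I, s i) * opCoeff t I * shiftHom q (ind I) f := by
  simp only [modifiedOp, qShift_eq hq]

lemma modifiedOp_eq_weightedOp (hq : q ≠ 0) (t : ℂ) (s : Fin n → ℂ) (r : ℕ) (f : AsympSeries n) :
    modifiedOp q t s r f = weightedOp q t (weight s r) f := by
  rw [modifiedOp_eq_sum hq, weightedOp_apply, Finset.powersetCard_eq_filter, Finset.powerset_univ,
    Finset.sum_filter]
  refine Finset.sum_congr rfl fun I _ => ?_
  unfold weight
  split_ifs <;> simp

lemma weightedOp_weightedOp (hq : q ≠ 0) (t : ℂ) (w w' : Finset (Fin n) → ℂ)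
    (f : AsympSeries n) :
    weightedOp q t w (weightedOp q t w' f) = ∑ I, ∑ J, MvPowerSeries.C (w I * w' J) *
      (opCoeff t I * shiftHom q (ind I) (opCoeff t J)) * shiftHom q (ind I + ind J) f := by
  rw [weightedOp_apply]
  refine Finset.sum_congr rfl fun I _ => ?_
  rw [weightedOp_apply, map_sum, Finset.mul_sum]
  refine Finset.sum_congr rfl fun J _ => ?_
  simp only [map_mul, shiftHom_C, shiftHom_shiftHom hq]
  ring

lemma modifiedOp_one_eq (hq : q ≠ 0) (t : ℂ) (s : Fin n → ℂ) (g : AsympSeries n) :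
    modifiedOp q t s 1 g =
      ∑ i, MvPowerSeries.C (s i) * opCoeff t {i} * shiftHom q (ind {i}) g := by
  rw [modifiedOp_eq_sum hq, Finset.powersetCard_one, Finset.sum_map]
  simp

lemma modifiedOp_one_modifiedOp (hq : q ≠ 0) (t : ℂ) (s : Fin n → ℂ) (r : ℕ)
    (f : AsympSeries n) :
    modifiedOp q t s 1 (modifiedOp q t s r f) =
      ∑ i, ∑ J ∈ (Finset.univ : Finset (Fin n)).powersetCard r,
        MvPowerSeries.C (s i * ∏ j ∈ J, s j) *
          (opCoeff t {i} * shiftHom q (ind {i}) (opCoeff t J)) *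
            shiftHom q (ind {i} + ind J) f := by
  rw [modifiedOp_one_eq hq]
  refine Finset.sum_congr rfl fun i _ => ?_
  rw [modifiedOp_eq_sum hq, map_sum, Finset.mul_sum]
  refine Finset.sum_congr rfl fun J _ => ?_
  simp only [map_mul, shiftHom_C, shiftHom_shiftHom hq]
  ring

lemma modifiedOp_modifiedOp_one (hq : q ≠ 0) (t : ℂ) (s : Fin n → ℂ) (r : ℕ)
    (f : AsympSeries n) :
    modifiedOp q t s r (modifiedOp q t s 1 f) =
      ∑ i, ∑ J ∈ (Finset.univ : Finset (Fin n)).powersetCard r,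
        MvPowerSeries.C (s i * ∏ j ∈ J, s j) *
          (opCoeff t J * shiftHom q (ind J) (opCoeff t {i})) *
            shiftHom q (ind {i} + ind J) f := by
  rw [modifiedOp_eq_sum hq, modifiedOp_one_eq hq, Finset.sum_comm]
  refine Finset.sum_congr rfl fun J _ => ?_
  rw [map_sum, Finset.mul_sum]
  refine Finset.sum_congr rfl fun i _ => ?_
  simp only [map_mul, shiftHom_C, shiftHom_shiftHom hq, add_comm (ind {i})]
  ring

lemma sum_opCoeff_comm (hq : q ≠ 0) (hq1 : q ≠ 1) {t : ℂ} (ht : t ≠ 0) (K : Finset (Fin n)) :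
    ∑ i ∈ K, opCoeff t {i} * shiftHom q (ind {i}) (opCoeff t (K.erase i)) =
      ∑ i ∈ K, opCoeff t (K.erase i) * shiftHom q (ind (K.erase i)) (opCoeff t {i}) := by
  rw [Finset.sum_congr rfl fun i hi => opCoeff_singleton_mul_erase hq t hi,
    Finset.sum_congr rfl fun i hi => opCoeff_erase_mul_singleton hq t hi,
    ← Finset.mul_sum, ← Finset.mul_sum, sum_prod_pairShift hq hq1 ht K]

theorem modifiedOp_one_comm (hq : q ≠ 0) (hq1 : q ≠ 1) {t : ℂ} (ht : t ≠ 0) (s : Fin n → ℂ)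
    (r : ℕ) (f : AsympSeries n) :
    modifiedOp q t s 1 (modifiedOp q t s r f) = modifiedOp q t s r (modifiedOp q t s 1 f) := by
  rw [modifiedOp_one_modifiedOp hq, modifiedOp_modifiedOp_one hq]
  have hsplit (F : Fin n → Finset (Fin n) → AsympSeries n) :
      ∑ i, ∑ J ∈ (Finset.univ : Finset (Fin n)).powersetCard r, F i J =
        ∑ i, ∑ J ∈ (Finset.univ : Finset (Fin n)).powersetCard r with i ∈ J, F i J +
          ∑ i, ∑ J ∈ (Finset.univ : Finset (Fin n)).powersetCard r with i ∉ J, F i J := by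
    rw [← Finset.sum_add_distrib]
    exact Finset.sum_congr rfl fun i _ => (Finset.sum_filter_add_sum_filter_not _ _ _).symm
  rw [hsplit, hsplit, sum_powersetCard_insert, sum_powersetCard_insert]
  refine congrArg₂ _ ?_ ?_
  · refine Finset.sum_congr rfl fun i _ => Finset.sum_congr rfl fun J hJ => ?_
    rw [opCoeff_singleton_mul_of_mem hq t (Finset.mem_filter.1 hJ).2]
  · refine Finset.sum_congr rfl fun K _ => ?_
    have hfactor (G : Fin n → AsympSeries n) :
        ∑ i ∈ K, MvPowerSeries.C (s i * ∏ j ∈ K.erase i, s j) * G i *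
            shiftHom q (ind {i} + ind (K.erase i)) f =
          MvPowerSeries.C (∏ j ∈ K, s j) * (∑ i ∈ K, G i) * shiftHom q (ind K) f := by
      rw [Finset.mul_sum, Finset.sum_mul]
      refine Finset.sum_congr rfl fun i hi => ?_
      rw [Finset.mul_prod_erase K s hi, ind_singleton_add_erase hi]
    rw [hfactor fun i => opCoeff t {i} * shiftHom q (ind {i}) (opCoeff t (K.erase i)),
      hfactor fun i => opCoeff t (K.erase i) * shiftHom q (ind (K.erase i)) (opCoeff t {i}),
      sum_opCoeff_comm hq hq1 ht K]

end Commutation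

/-! ### Triangularity and normalized eigenfunctions -/

section ConstantTerm

variable {n : ℕ}

/-- The exponent `(k, …, k)` of `p ^ k`. -/
noncomputable def constExp (n k : ℕ) : Fin n →₀ ℕ := Finsupp.equivFunOnFinite.symm fun _ => k

lemma constExp_apply (k : ℕ) (i : Fin n) : constExp n k i = k := rfl

lemma constExp_zero : constExp n 0 = 0 := by ext; rfl

lemma coeff_mul_of_forall_lt {σ R : Type*} [CommSemiring R] (g h : MvPowerSeries σ R)
    (β : σ →₀ ℕ) (hh : ∀ γ < β, MvPowerSeries.coeff γ h = 0) :
    MvPowerSeries.coeff β (g * h) =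
      MvPowerSeries.constantCoeff g * MvPowerSeries.coeff β h := by
  classical
  rw [MvPowerSeries.coeff_mul, Finset.sum_eq_single (0, β)]
  · rw [MvPowerSeries.coeff_zero_eq_constantCoeff_apply]
  · rintro ⟨α, γ⟩ hadd hne
    rw [Finset.HasAntidiagonal.mem_antidiagonal] at hadd
    subst hadd
    have hα : α ≠ 0 := by
      rintro rfl
      exact hne (by rw [zero_add])
    rw [hh γ (lt_add_of_pos_left γ (pos_iff_ne_zero.2 hα)), mul_zero]
  · exact fun h0 => absurd (Finset.HasAntidiagonal.mem_antidiagonal.2 (zero_add β)) h0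

/-- The constant term of `f` with respect to `x` is `1`. -/
def IsNormalized (f : AsympSeries n) : Prop :=
  ∀ k : ℕ, MvPowerSeries.coeff (constExp n k) f = if k = 0 then 1 else 0

lemma IsNormalized.coeff_zero {f : AsympSeries n} (hf : IsNormalized f) :
    MvPowerSeries.coeff 0 f = 1 := by
  rw [← constExp_zero, hf 0, if_pos rfl]

lemma constantCoeff_opCoeff (t : ℂ) (I : Finset (Fin n)) :
    MvPowerSeries.constantCoeff (opCoeff t I) = 1 := by
  rw [opCoeff_eq, map_prod]
  refine Finset.prod_eq_one fun i _ => ?_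
  rw [map_prod]
  refine Finset.prod_eq_one fun j _ => ?_
  rw [pairCoeff, map_mul, MvPowerSeries.constantCoeff_inv, constantCoeff_thetaPair,
    constantCoeff_thetaPair, inv_one, mul_one]

variable [NeZero n]

lemma eq_constExp {β : Fin n →₀ ℕ} (h : ∀ i, β i = β 0) : β = constExp n (β 0) := by
  ext i
  exact h i

lemma expo_constExp (k : ℕ) : expo (constExp n k) = 0 := by
  funext i
  simp [expo, constExp_apply]

lemma expo_zero : expo (0 : Fin n →₀ ℕ) = 0 := by
  rw [← constExp_zero, expo_constExp]

lemma eq_constExp_of_expo_eq_zero {β : Fin n →₀ ℕ} (h : expo β = 0) : β = constExp n (β 0) := by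
  have hstep (i : Fin n) : β i = β (i + 1) := by
    have := congrFun h i
    simp only [expo, Pi.zero_apply] at this
    omega
  have hconst (m : ℕ) (hm : m < n) : β ⟨m, hm⟩ = β 0 := by
    induction m with
    | zero => rfl
    | succ m ih =>
      rw [← ih (by omega), hstep ⟨m, by omega⟩]
      congr 1
      refine Fin.ext ?_
      rw [val_add_one_eq, if_neg (by simp only; omega)]
  exact eq_constExp fun i => hconst i.val i.isLt

lemma coeff_ofNomeSeries (ε : PowerSeries ℂ) (β : Fin n →₀ ℕ) :
    MvPowerSeries.coeff β (ofNomeSeries ε) =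
      if ∀ i, β i = β 0 then PowerSeries.coeff (β 0) ε else 0 := rfl

lemma eq_constExp_of_coeff_ofNomeSeries_ne_zero {ε : PowerSeries ℂ} {β : Fin n →₀ ℕ}
    (h : MvPowerSeries.coeff β (ofNomeSeries ε) ≠ 0) : β = constExp n (β 0) := by
  rw [coeff_ofNomeSeries, ne_eq, ite_eq_right_iff, Classical.not_imp] at h
  exact eq_constExp h.1

lemma coeff_constExp_ofNomeSeries (ε : PowerSeries ℂ) (k : ℕ) :
    MvPowerSeries.coeff (constExp n k) (ofNomeSeries ε : AsympSeries n) =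
      PowerSeries.coeff k ε := by
  simp [coeff_ofNomeSeries, constExp_apply]

lemma constantCoeff_ofNomeSeries (ε : PowerSeries ℂ) :
    MvPowerSeries.constantCoeff (ofNomeSeries ε : AsympSeries n) = PowerSeries.coeff 0 ε := by
  rw [← MvPowerSeries.coeff_zero_eq_constantCoeff_apply, ← constExp_zero,
    coeff_constExp_ofNomeSeries]

lemma IsNormalized.coeff_constExp_mul {f : AsympSeries n} (hf : IsNormalized f)
    (ε : PowerSeries ℂ) (k : ℕ) :
    MvPowerSeries.coeff (constExp n k) (ofNomeSeries ε * f) = PowerSeries.coeff k ε := by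
  classical
  rw [MvPowerSeries.coeff_mul, Finset.sum_eq_single (constExp n k, 0)]
  · rw [hf.coeff_zero, mul_one, coeff_constExp_ofNomeSeries]
  · rintro ⟨α, γ⟩ hadd hne
    rw [Finset.HasAntidiagonal.mem_antidiagonal] at hadd
    by_cases hα : MvPowerSeries.coeff α (ofNomeSeries ε : AsympSeries n) = 0
    · rw [hα, zero_mul]
    have hα' := eq_constExp_of_coeff_ofNomeSeries_ne_zero hα
    have hγ : γ = constExp n (γ 0) := eq_constExp fun i => by
      have hi : α i + γ i = k := DFunLike.congr_fun hadd i
      have h0 : α 0 + γ 0 = k := DFunLike.congr_fun hadd 0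
      rw [hα', constExp_apply] at hi
      omega
    have hγ0 : γ 0 ≠ 0 := by
      intro h0
      rw [h0, constExp_zero] at hγ
      exact hne (by rw [← hadd, hγ, add_zero])
    rw [hγ, hf, if_neg hγ0, mul_zero]
  · exact fun h0 => absurd (Finset.HasAntidiagonal.mem_antidiagonal.2 (add_zero _)) h0

end ConstantTerm

section Triangular

lemma existsUnique_fixed_point {α R : Type*} [Preorder α] [WellFoundedLT α] [Zero R]
    (G : (α → R) → α → R) (hG : ∀ f g β, (∀ γ < β, f γ = g γ) → G f β = G g β) :
    ∃! f, G f = f := by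
  classical
  let f : α → R := (wellFounded_lt (α := α)).fix fun β rec =>
    G (fun γ => if h : γ < β then rec γ h else 0) β
  have hf (β) : f β = G f β := by
    have hfix : f β = G (fun γ => if γ < β then f γ else 0) β := WellFounded.fix_eq _ _ _
    rw [hfix]
    exact hG _ _ _ fun γ hγ => if_pos hγ
  refine ⟨f, (funext hf).symm, fun g hg => ?_⟩
  funext β
  induction β using WellFoundedLT.induction with
  | _ β ih =>
    rw [hf, ← hg]
    exact hG _ _ _ fun γ hγ => ih γ hγ

variable {n : ℕ} [NeZero n]

/-- The diagonal entry of `weightedOp` at a monomial with exponents `l`. -/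
noncomputable def diagEntry (q : ℂ) (w : Finset (Fin n) → ℂ) (l : Fin n → ℤ) : ℂ :=
  ∑ I, w I * q ^ (∑ i, ind I i * l i)

/-- Nondegeneracy of `weightedOp`: the diagonal entries at the monomials with a nonzero exponent in
`x` differ from the one at the powers of the nome. -/
def IsNondegenerate (q : ℂ) (w : Finset (Fin n) → ℂ) : Prop :=
  ∀ β : Fin n →₀ ℕ, β ≠ constExp n (β 0) → diagEntry q w (expo β) ≠ diagEntry q w 0

/-- The eigenvalue forced on a normalized eigenfunction `f`, read off the constant term with
respect to `x` of its image. The value at `k = 0`, which is the coefficient of `weightedOp q t w f`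
for normalized `f`, is made independent of `f`. -/
noncomputable def forcedEigenvalue (q t : ℂ) (w : Finset (Fin n) → ℂ) (f : AsympSeries n) :
    PowerSeries ℂ :=
  PowerSeries.mk fun k => if k = 0 then diagEntry q w 0 else
    MvPowerSeries.coeff (constExp n k) (weightedOp q t w f)

open Classical in
/-- The map whose fixed points are the normalized eigenfunctions: the coefficients at the powers of
the nome are prescribed, the others are corrected by the defect of the eigenvalue equation divided
by the difference of the diagonal entries. -/
noncomputable def eigenStep (q t : ℂ) (w : Finset (Fin n) → ℂ) (f : AsympSeries n) :
    AsympSeries n := fun β : Fin n →₀ ℕ =>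
  if β = constExp n (β 0) then (if β 0 = 0 then 1 else 0) else
    MvPowerSeries.coeff β f + (diagEntry q w (expo β) - diagEntry q w 0)⁻¹ *
      MvPowerSeries.coeff β (ofNomeSeries (forcedEigenvalue q t w f) * f - weightedOp q t w f)

variable {q : ℂ}

lemma coeff_weightedOp_of_forall_lt (hq : q ≠ 0) (t : ℂ) (w : Finset (Fin n) → ℂ)
    (h : AsympSeries n) (β : Fin n →₀ ℕ) (hh : ∀ γ < β, MvPowerSeries.coeff γ h = 0) :
    MvPowerSeries.coeff β (weightedOp q t w h) =
      diagEntry q w (expo β) * MvPowerSeries.coeff β h := by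
  rw [weightedOp_apply, map_sum, diagEntry, Finset.sum_mul]
  refine Finset.sum_congr rfl fun I _ => ?_
  rw [coeff_mul_of_forall_lt _ _ β fun γ hγ => by rw [coeff_shiftHom hq, hh γ hγ, mul_zero],
    map_mul, constantCoeff_opCoeff, MvPowerSeries.constantCoeff_C, mul_one, coeff_shiftHom hq,
    mul_assoc]

lemma IsNormalized.coeff_zero_weightedOp (hq : q ≠ 0) (t : ℂ) (w : Finset (Fin n) → ℂ)
    {f : AsympSeries n} (hf : IsNormalized f) :
    MvPowerSeries.coeff 0 (weightedOp q t w f) = diagEntry q w 0 := by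
  rw [coeff_weightedOp_of_forall_lt hq t w f 0 fun γ hγ => absurd hγ not_lt_zero, hf.coeff_zero,
    expo_zero, mul_one]

lemma IsNormalized.coeff_forcedEigenvalue (hq : q ≠ 0) (t : ℂ) (w : Finset (Fin n) → ℂ)
    {f : AsympSeries n} (hf : IsNormalized f) (k : ℕ) :
    PowerSeries.coeff k (forcedEigenvalue q t w f) =
      MvPowerSeries.coeff (constExp n k) (weightedOp q t w f) := by
  rw [forcedEigenvalue, PowerSeries.coeff_mk]
  split_ifs with hk
  · rw [hk, constExp_zero, hf.coeff_zero_weightedOp hq]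
  · rfl

lemma shiftHom_ofNomeSeries (hq : q ≠ 0) (M : Fin n → ℤ) (ε : PowerSeries ℂ) :
    shiftHom q M (ofNomeSeries ε) = (ofNomeSeries ε : AsympSeries n) := by
  ext β
  rw [coeff_shiftHom hq]
  by_cases h : MvPowerSeries.coeff β (ofNomeSeries ε : AsympSeries n) = 0
  · rw [h, mul_zero]
  · rw [eq_constExp_of_coeff_ofNomeSeries_ne_zero h, expo_constExp]
    simp

lemma weightedOp_ofNomeSeries_mul (hq : q ≠ 0) (t : ℂ) (w : Finset (Fin n) → ℂ)
    (ε : PowerSeries ℂ) (f : AsympSeries n) :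
    weightedOp q t w (ofNomeSeries ε * f) = ofNomeSeries ε * weightedOp q t w f := by
  rw [weightedOp_apply, weightedOp_apply, Finset.mul_sum]
  refine Finset.sum_congr rfl fun I _ => ?_
  rw [map_mul, shiftHom_ofNomeSeries hq]
  ring

lemma coeff_eigenStep_constExp (t : ℂ) (w : Finset (Fin n) → ℂ) (f : AsympSeries n) (k : ℕ) :
    MvPowerSeries.coeff (constExp n k) (eigenStep q t w f) = if k = 0 then 1 else 0 := by
  change eigenStep q t w f (constExp n k) = _
  rw [eigenStep, if_pos (by rw [constExp_apply]), constExp_apply]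

lemma coeff_eigenStep {β : Fin n →₀ ℕ} (hβ : β ≠ constExp n (β 0)) (t : ℂ)
    (w : Finset (Fin n) → ℂ) (f : AsympSeries n) :
    MvPowerSeries.coeff β (eigenStep q t w f) =
      MvPowerSeries.coeff β f + (diagEntry q w (expo β) - diagEntry q w 0)⁻¹ *
        MvPowerSeries.coeff β
          (ofNomeSeries (forcedEigenvalue q t w f) * f - weightedOp q t w f) := by
  change eigenStep q t w f β = _
  rw [eigenStep, if_neg hβ]

lemma coeff_forcedEigenvalue_congr (hq : q ≠ 0) (t : ℂ) (w : Finset (Fin n) → ℂ)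
    {f g : AsympSeries n} {k : ℕ}
    (h : ∀ γ ≤ constExp n k, MvPowerSeries.coeff γ (f - g) = 0) :
    PowerSeries.coeff k (forcedEigenvalue q t w f) =
      PowerSeries.coeff k (forcedEigenvalue q t w g) := by
  rw [forcedEigenvalue, forcedEigenvalue, PowerSeries.coeff_mk, PowerSeries.coeff_mk]
  split_ifs
  · rfl
  · rw [← sub_eq_zero, ← map_sub, ← map_sub,
      coeff_weightedOp_of_forall_lt hq t w _ _ fun γ hγ => h γ hγ.le, h _ le_rfl, mul_zero]

lemma coeff_ofNomeSeries_forcedEigenvalue_mul_congr (hq : q ≠ 0) (t : ℂ)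
    (w : Finset (Fin n) → ℂ) {f g : AsympSeries n} {β : Fin n →₀ ℕ} (hβ : β ≠ constExp n (β 0))
    (h : ∀ γ < β, MvPowerSeries.coeff γ (f - g) = 0) (u : AsympSeries n) :
    MvPowerSeries.coeff β (ofNomeSeries (forcedEigenvalue q t w f) * u) =
      MvPowerSeries.coeff β (ofNomeSeries (forcedEigenvalue q t w g) * u) := by
  classical
  rw [MvPowerSeries.coeff_mul, MvPowerSeries.coeff_mul]
  refine Finset.sum_congr rfl fun x hx => congrArg (· * _) ?_
  rw [coeff_ofNomeSeries, coeff_ofNomeSeries]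
  refine if_ctx_congr Iff.rfl (fun hconst => ?_) fun _ => rfl
  have hx1 := eq_constExp hconst
  have hle : x.1 ≤ β := Finset.HasAntidiagonal.mem_antidiagonal.1 hx ▸ le_self_add
  have hlt : x.1 < β := lt_of_le_of_ne hle fun heq => hβ (heq ▸ hx1)
  exact coeff_forcedEigenvalue_congr hq t w fun γ hγ => h γ ((hγ.trans_eq hx1.symm).trans_lt hlt)

lemma eigenStep_congr (hq : q ≠ 0) (t : ℂ) {w : Finset (Fin n) → ℂ} (hw : IsNondegenerate q w)
    (f g : AsympSeries n) (β : Fin n →₀ ℕ)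
    (h : ∀ γ < β, MvPowerSeries.coeff γ f = MvPowerSeries.coeff γ g) :
    MvPowerSeries.coeff β (eigenStep q t w f) = MvPowerSeries.coeff β (eigenStep q t w g) := by
  by_cases hβ : β = constExp n (β 0)
  · rw [hβ, coeff_eigenStep_constExp, coeff_eigenStep_constExp]
  have hfg (γ) (hγ : γ < β) : MvPowerSeries.coeff γ (f - g) = 0 := by
    rw [map_sub, h γ hγ, sub_self]
  have hop := coeff_weightedOp_of_forall_lt hq t w (f - g) β hfg
  have hmul := coeff_mul_of_forall_lt (ofNomeSeries (forcedEigenvalue q t w f)) (f - g) β hfg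
  have heigen := coeff_ofNomeSeries_forcedEigenvalue_mul_congr hq t w hβ hfg g
  have hconst : PowerSeries.coeff 0 (forcedEigenvalue q t w f) = diagEntry q w 0 := by
    rw [forcedEigenvalue, PowerSeries.coeff_mk, if_pos rfl]
  rw [constantCoeff_ofNomeSeries, hconst, mul_sub, map_sub, map_sub] at hmul
  rw [map_sub, map_sub, map_sub] at hop
  rw [coeff_eigenStep hβ, coeff_eigenStep hβ, map_sub, map_sub]
  field_simp [sub_ne_zero.2 (hw β hβ)]
  linear_combination hmul + heigen - hop

lemma eigenStep_eq_iff (hq : q ≠ 0) (t : ℂ) {w : Finset (Fin n) → ℂ} (hw : IsNondegenerate q w)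
    {f : AsympSeries n} :
    eigenStep q t w f = f ↔ IsNormalized f ∧
      weightedOp q t w f = ofNomeSeries (forcedEigenvalue q t w f) * f := by
  constructor
  · intro hf
    have hnorm : IsNormalized f := fun k => by
      rw [← coeff_eigenStep_constExp (q := q) t w f k, hf]
    refine ⟨hnorm, ?_⟩
    ext β
    by_cases hβ : β = constExp n (β 0)
    · rw [hβ, hnorm.coeff_constExp_mul, hnorm.coeff_forcedEigenvalue hq]
    · have hstep := coeff_eigenStep (q := q) hβ t w f
      rw [hf, left_eq_add, mul_eq_zero, inv_eq_zero, map_sub, sub_eq_zero, sub_eq_zero] at hstep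
      exact (hstep.resolve_left (hw β hβ)).symm
  · rintro ⟨hnorm, hf⟩
    ext β
    by_cases hβ : β = constExp n (β 0)
    · rw [hβ, coeff_eigenStep_constExp, hnorm]
    · rw [coeff_eigenStep hβ, ← hf, sub_self, map_zero, mul_zero, add_zero]

lemma existsUnique_eigenStep (hq : q ≠ 0) (t : ℂ) {w : Finset (Fin n) → ℂ}
    (hw : IsNondegenerate q w) : ∃! f : AsympSeries n, eigenStep q t w f = f :=
  existsUnique_fixed_point (eigenStep q t w) (eigenStep_congr hq t hw)

theorem exists_eigenfunction (hq : q ≠ 0) (t : ℂ) {w : Finset (Fin n) → ℂ}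
    (hw : IsNondegenerate q w) : ∃ (f : AsympSeries n) (ε : PowerSeries ℂ), IsNormalized f ∧
      weightedOp q t w f = ofNomeSeries ε * f := by
  obtain ⟨f, hf, -⟩ := existsUnique_eigenStep hq t hw
  have hnorm := (eigenStep_eq_iff hq t hw).1 hf
  exact ⟨f, forcedEigenvalue q t w f, hnorm⟩

lemma eq_forcedEigenvalue (hq : q ≠ 0) (t : ℂ) {w : Finset (Fin n) → ℂ} {f : AsympSeries n}
    (hf : IsNormalized f) {ε : PowerSeries ℂ} (h : weightedOp q t w f = ofNomeSeries ε * f) :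
    ε = forcedEigenvalue q t w f := by
  ext k
  rw [hf.coeff_forcedEigenvalue hq, h, hf.coeff_constExp_mul]

theorem eigenfunction_unique (hq : q ≠ 0) (t : ℂ) {w : Finset (Fin n) → ℂ}
    (hw : IsNondegenerate q w) {f g : AsympSeries n} (hf : IsNormalized f) (hg : IsNormalized g)
    {ε η : PowerSeries ℂ} (hfε : weightedOp q t w f = ofNomeSeries ε * f)
    (hgη : weightedOp q t w g = ofNomeSeries η * g) : f = g := by
  refine (existsUnique_eigenStep hq t hw).unique ((eigenStep_eq_iff hq t hw).2 ⟨hf, ?_⟩)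
    ((eigenStep_eq_iff hq t hw).2 ⟨hg, ?_⟩)
  · rw [← eq_forcedEigenvalue hq t hf hfε, hfε]
  · rw [← eq_forcedEigenvalue hq t hg hgη, hgη]

lemma eq_zero_of_weightedOp_eq (hq : q ≠ 0) (t : ℂ) {w : Finset (Fin n) → ℂ}
    (hw : IsNondegenerate q w) {ε : PowerSeries ℂ} (hε : PowerSeries.coeff 0 ε = diagEntry q w 0)
    {h : AsympSeries n} (h0 : ∀ k, MvPowerSeries.coeff (constExp n k) h = 0)
    (hhε : weightedOp q t w h = ofNomeSeries ε * h) : h = 0 := by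
  ext β
  induction β using WellFoundedLT.induction with
  | _ β ih =>
    by_cases hβ : β = constExp n (β 0)
    · rw [hβ, h0, map_zero]
    · have hcoeff := congrArg (MvPowerSeries.coeff β) hhε
      rw [coeff_weightedOp_of_forall_lt hq t w h β ih, coeff_mul_of_forall_lt _ h β ih,
        constantCoeff_ofNomeSeries, hε] at hcoeff
      exact (mul_eq_mul_right_iff.1 hcoeff).resolve_left (hw β hβ)

theorem eigenspace_eq (hq : q ≠ 0) (t : ℂ) {w : Finset (Fin n) → ℂ} (hw : IsNondegenerate q w)
    {f g : AsympSeries n} (hf : IsNormalized f) {ε : PowerSeries ℂ}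
    (hfε : weightedOp q t w f = ofNomeSeries ε * f)
    (hgε : weightedOp q t w g = ofNomeSeries ε * g) :
    ∃ η : PowerSeries ℂ, g = ofNomeSeries η * f := by
  let η : PowerSeries ℂ := PowerSeries.mk fun k => MvPowerSeries.coeff (constExp n k) g
  refine ⟨η, sub_eq_zero.1 (eq_zero_of_weightedOp_eq hq t hw (ε := ε) ?_ (fun k => ?_) ?_)⟩
  · rw [eq_forcedEigenvalue hq t hf hfε, forcedEigenvalue, PowerSeries.coeff_mk, if_pos rfl]
  · rw [map_sub, hf.coeff_constExp_mul, PowerSeries.coeff_mk, sub_self]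
  · rw [map_sub, weightedOp_ofNomeSeries_mul hq, hfε, hgε]
    ring

end Triangular

/-! ### Commutation of all the operators -/

section Avoidance

lemma zpow_injective_of_norm_lt_one {𝕜 : Type*} [NormedDivisionRing 𝕜] {q : 𝕜} (hq : q ≠ 0)
    (hq1 : ‖q‖ < 1) : Function.Injective fun m : ℤ => q ^ m := by
  intro l m h
  have hnorm : ‖q‖ ^ l = ‖q‖ ^ m := by
    rw [← norm_zpow, ← norm_zpow]
    exact congrArg norm h
  exact zpow_right_injective₀ (norm_pos_iff.2 hq) hq1.ne hnorm

lemma infinite_setOf_eval_ne_zero {α : Type*} [Countable α] (p : α → Polynomial ℂ)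
    (hp : ∀ a, p a ≠ 0) : {v : ℂ | ∀ a, (p a).eval v ≠ 0}.Infinite := by
  intro hfin
  have hcompl : {v : ℂ | ∀ a, (p a).eval v ≠ 0}ᶜ = ⋃ a, {v | (p a).IsRoot v} := by
    ext v
    simp
  have hcountable : {v : ℂ | ∀ a, (p a).eval v ≠ 0}ᶜ.Countable := by
    rw [hcompl]
    exact Set.countable_iUnion fun a => (Polynomial.finite_setOfPred_isRoot (hp a)).countable
  have huniv := hfin.countable.union hcountable
  rw [Set.union_compl_self] at huniv
  exact not_countable_complex huniv

end Avoidance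

section Separation

variable {n : ℕ}

/-- The point `(q ^ (l_i) s_i)`. -/
noncomputable def scaleParam (q : ℂ) (s : Fin n → ℂ) (l : Fin n → ℤ) (i : Fin n) : ℂ :=
  s i * q ^ l i

/-- The eigenvalues `∑ s_i q ^ (l_i)` of the leading part of the operator of order one separate the
exponents `l`. -/
def IsSeparating (q : ℂ) (s : Fin n → ℂ) : Prop :=
  ∀ l m : Fin n → ℤ, l ≠ m → ∑ i, s i * q ^ l i ≠ ∑ i, s i * q ^ m i

/-- The curve `v ↦ (s_i + v ^ (i + 1))` through `s`, which lies in no hyperplane; it is used to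
deform `s` into separating parameters. -/
def momentCurve (s : Fin n → ℂ) (v : ℂ) (i : Fin n) : ℂ := s i + v ^ (i.val + 1)

lemma momentCurve_zero (s : Fin n → ℂ) : momentCurve s 0 = s := by
  funext i
  simp [momentCurve]

variable {q : ℂ}

lemma IsSeparating.scaleParam (hq : q ≠ 0) {s : Fin n → ℂ} (hs : IsSeparating q s)
    (k : Fin n → ℤ) : IsSeparating q (scaleParam q s k) := by
  intro l m hlm
  simp only [Ruijsenaars.scaleParam, mul_assoc, ← zpow_add₀ hq]
  exact hs (k + l) (k + m) fun h => hlm (add_left_cancel h)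

lemma weight_scaleParam (hq : q ≠ 0) (s : Fin n → ℂ) (l : Fin n → ℤ) (r : ℕ)
    (I : Finset (Fin n)) :
    weight (scaleParam q s l) r I = weight s r I * q ^ (∑ i, ind I i * l i) := by
  unfold weight
  split_ifs
  · simp only [scaleParam, Finset.prod_mul_distrib, prod_zpow_eq_zpow_sum hq]
    simp [ind]
  · rw [zero_mul]

lemma infinite_setOf_isSeparating_momentCurve (hq : q ≠ 0) (hq1 : ‖q‖ < 1) (s : Fin n → ℂ) :
    {v : ℂ | IsSeparating q (momentCurve s v)}.Infinite := by
  let p (x : {x : (Fin n → ℤ) × (Fin n → ℤ) // x.1 ≠ x.2}) : Polynomial ℂ := ∑ i : Fin n,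
    (Polynomial.C (s i) + Polynomial.X ^ (i.val + 1)) *
      Polynomial.C (q ^ x.1.1 i - q ^ x.1.2 i)
  have hp (x) : p x ≠ 0 := by
    obtain ⟨⟨l, m⟩, hlm⟩ := x
    intro h0
    obtain ⟨k, hk⟩ := Function.ne_iff.1 hlm
    have hcoeff := congrArg (fun P => Polynomial.coeff P (k.val + 1)) h0
    simp only [p, Polynomial.finsetSum_coeff, Polynomial.coeff_mul_C, Polynomial.coeff_add,
      Polynomial.coeff_C_succ, Polynomial.coeff_X_pow, Polynomial.coeff_zero, zero_add,
      add_left_inj, ite_mul, one_mul, zero_mul, ← Fin.ext_iff] at hcoeff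
    rw [Finset.sum_ite_eq, if_pos (Finset.mem_univ _)] at hcoeff
    exact hk (zpow_injective_of_norm_lt_one hq hq1 (sub_eq_zero.1 hcoeff))
  refine (infinite_setOf_eval_ne_zero p hp).mono fun v hv l m hlm heq => ?_
  apply hv ⟨(l, m), hlm⟩
  simp only [p, Polynomial.eval_finsetSum, Polynomial.eval_mul, Polynomial.eval_add,
    Polynomial.eval_C, Polynomial.eval_pow, Polynomial.eval_X, mul_sub, Finset.sum_sub_distrib]
  exact sub_eq_zero.2 heq

lemma diagEntry_weight (hq : q ≠ 0) (s : Fin n → ℂ) (r : ℕ) (l : Fin n → ℤ) :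
    diagEntry q (weight s r) l =
      ∑ I ∈ (Finset.univ : Finset (Fin n)).powersetCard r, ∏ i ∈ I, s i * q ^ l i := by
  simp only [diagEntry, ← weight_scaleParam hq]
  rw [Finset.powersetCard_eq_filter, Finset.powerset_univ, Finset.sum_filter]
  rfl

variable [NeZero n]

lemma IsSeparating.isNondegenerate (hq : q ≠ 0) {s : Fin n → ℂ} (hs : IsSeparating q s) :
    IsNondegenerate q (weight s 1) := by
  intro β hβ
  simp only [diagEntry_weight hq, Finset.powersetCard_one, Finset.sum_map,
    Function.Embedding.coeFn_mk, Finset.prod_singleton]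
  exact hs _ _ fun h => hβ (eq_constExp_of_expo_eq_zero h)

end Separation

section Commutator

variable {n : ℕ} [NeZero n] {q : ℂ}

/-- The coefficient of `T^I T^J` in a commutator. -/
noncomputable def commCoeff (q t : ℂ) (I J : Finset (Fin n)) : AsympSeries n :=
  opCoeff t I * shiftHom q (ind I) (opCoeff t J) - opCoeff t J * shiftHom q (ind J) (opCoeff t I)

/-- The commutator of the operators of orders `a` and `b`, applied to `1`. -/
noncomputable def commSymbol (q t : ℂ) (s : Fin n → ℂ) (a b : ℕ) : AsympSeries n :=
  ∑ I, ∑ J, MvPowerSeries.C (weight s a I * weight s b J) * commCoeff q t I J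

lemma coeff_commSymbol (t : ℂ) (s : Fin n → ℂ) (a b : ℕ) (γ : Fin n →₀ ℕ) :
    MvPowerSeries.coeff γ (commSymbol q t s a b) = ∑ I, ∑ J,
      weight s a I * weight s b J * MvPowerSeries.coeff γ (commCoeff q t I J) := by
  simp only [commSymbol, map_sum, MvPowerSeries.coeff_C_mul]

lemma commutator_eq (hq : q ≠ 0) (t : ℂ) (s : Fin n → ℂ) (a b : ℕ) (f : AsympSeries n) :
    weightedOp q t (weight s a) (weightedOp q t (weight s b) f) -
      weightedOp q t (weight s b) (weightedOp q t (weight s a) f) =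
    ∑ I, ∑ J, MvPowerSeries.C (weight s a I * weight s b J) * (commCoeff q t I J *
      shiftHom q (ind I + ind J) f) := by
  rw [weightedOp_weightedOp hq, weightedOp_weightedOp hq t (weight s b), Finset.sum_comm (f :=
    fun I J => MvPowerSeries.C (weight s b I * weight s a J) * _ * shiftHom q (ind I + ind J) f)]
  rw [← Finset.sum_sub_distrib]
  refine Finset.sum_congr rfl fun I _ => ?_
  rw [← Finset.sum_sub_distrib]
  refine Finset.sum_congr rfl fun J _ => ?_
  rw [commCoeff, add_comm (ind J), mul_comm (weight s b J)]
  ring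

/- The shift `T^I T^J` acts on `z ^ x` by a scalar that is absorbed by rescaling `s`. -/
lemma coeff_commutator (hq : q ≠ 0) (t : ℂ) (s : Fin n → ℂ) (a b : ℕ) (f : AsympSeries n)
    (γ : Fin n →₀ ℕ) :
    MvPowerSeries.coeff γ (weightedOp q t (weight s a) (weightedOp q t (weight s b) f) -
      weightedOp q t (weight s b) (weightedOp q t (weight s a) f)) =
    ∑ x ∈ Finset.HasAntidiagonal.antidiagonal γ,
      MvPowerSeries.coeff x.1 (commSymbol q t (scaleParam q s (expo x.2)) a b) *
        MvPowerSeries.coeff x.2 f := by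
  classical
  simp only [commutator_eq hq, map_sum, coeff_commSymbol, Finset.sum_mul]
  conv_rhs => rw [Finset.sum_comm]
  refine Finset.sum_congr rfl fun I _ => ?_
  conv_rhs => rw [Finset.sum_comm]
  refine Finset.sum_congr rfl fun J _ => ?_
  rw [MvPowerSeries.coeff_C_mul, MvPowerSeries.coeff_mul, Finset.mul_sum]
  refine Finset.sum_congr rfl fun x _ => ?_
  rw [coeff_shiftHom hq, weight_scaleParam hq, weight_scaleParam hq]
  simp only [Pi.add_apply, add_mul, Finset.sum_add_distrib, zpow_add₀ hq]
  ring

theorem exists_joint_eigenfunction (hq : q ≠ 0) (t : ℂ) {w : Finset (Fin n) → ℂ}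
    (hw : IsNondegenerate q w) {ι : Type*} (v : ι → Finset (Fin n) → ℂ)
    (hcomm : ∀ k f, weightedOp q t w (weightedOp q t (v k) f) =
      weightedOp q t (v k) (weightedOp q t w f)) :
    ∃ f, IsNormalized f ∧
      ∀ k, ∃ η : PowerSeries ℂ, weightedOp q t (v k) f = ofNomeSeries η * f := by
  obtain ⟨f, ε, hf, hfε⟩ := exists_eigenfunction hq t hw
  refine ⟨f, hf, fun k => eigenspace_eq hq t hw hf hfε ?_⟩
  rw [hcomm, hfε, weightedOp_ofNomeSeries_mul hq]

lemma weightedOp_weight_one_comm (hq : q ≠ 0) (hq1 : q ≠ 1) {t : ℂ} (ht : t ≠ 0) (s : Fin n → ℂ)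
    (r : ℕ) (f : AsympSeries n) :
    weightedOp q t (weight s 1) (weightedOp q t (weight s r) f) =
      weightedOp q t (weight s r) (weightedOp q t (weight s 1) f) := by
  simpa only [modifiedOp_eq_weightedOp hq] using modifiedOp_one_comm hq hq1 ht s r f

lemma coeff_commSymbol_eq_zero_of_isSeparating (hq : q ≠ 0) (hq1 : q ≠ 1) {t : ℂ} (ht : t ≠ 0)
    {s : Fin n → ℂ} (hs : IsSeparating q s) (a b : ℕ) (γ : Fin n →₀ ℕ) :
    MvPowerSeries.coeff γ (commSymbol q t s a b) = 0 := by
  classical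
  induction γ using WellFoundedLT.induction generalizing s with
  | _ γ ih =>
    obtain ⟨f, hf, heigen⟩ := exists_joint_eigenfunction hq t (hs.isNondegenerate hq) (weight s)
      (weightedOp_weight_one_comm hq hq1 ht s)
    obtain ⟨η, hη⟩ := heigen a
    obtain ⟨ζ, hζ⟩ := heigen b
    have hsum := coeff_commutator hq t s a b f γ
    rw [hη, hζ, weightedOp_ofNomeSeries_mul hq, weightedOp_ofNomeSeries_mul hq, hη, hζ,
      mul_left_comm, sub_self, map_zero, Finset.sum_eq_single (γ, 0)] at hsum
    · have hscale : scaleParam q s 0 = s := by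
        funext i
        simp [scaleParam]
      simpa only [hf.coeff_zero, mul_one, expo_zero, hscale] using hsum.symm
    · rintro ⟨α, β⟩ hadd hne
      rw [Finset.HasAntidiagonal.mem_antidiagonal] at hadd
      subst hadd
      have hβ : β ≠ 0 := by
        rintro rfl
        exact hne (by rw [add_zero])
      rw [ih α (lt_add_of_pos_right α (pos_iff_ne_zero.2 hβ)) (hs.scaleParam hq _), zero_mul]
    · exact fun h => absurd (Finset.HasAntidiagonal.mem_antidiagonal.2 (add_zero γ)) h

lemma exists_polynomial_eval_eq_coeff_commSymbol (q t : ℂ) (s : Fin n → ℂ) (a b : ℕ)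
    (γ : Fin n →₀ ℕ) : ∃ P : Polynomial ℂ, ∀ v,
      P.eval v = MvPowerSeries.coeff γ (commSymbol q t (momentCurve s v) a b) := by
  let W (r : ℕ) (I : Finset (Fin n)) : Polynomial ℂ :=
    if I.card = r then ∏ i ∈ I, (Polynomial.C (s i) + Polynomial.X ^ (i.val + 1)) else 0
  have hW (v r I) : (W r I).eval v = weight (momentCurve s v) r I := by
    simp only [W, weight, momentCurve]
    split_ifs
    · simp [Polynomial.eval_prod]
    · simp
  refine ⟨∑ I, ∑ J, W a I * W b J *
    Polynomial.C (MvPowerSeries.coeff γ (commCoeff q t I J)), fun v => ?_⟩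
  simp only [Polynomial.eval_finsetSum, Polynomial.eval_mul, hW, Polynomial.eval_C,
    coeff_commSymbol]

lemma commSymbol_eq_zero (hq : q ≠ 0) (hq1 : ‖q‖ < 1) {t : ℂ} (ht : t ≠ 0) (s : Fin n → ℂ)
    (a b : ℕ) : commSymbol q t s a b = 0 := by
  have hq_ne_one : q ≠ 1 := by
    rintro rfl
    simp at hq1
  ext γ
  obtain ⟨P, hP⟩ := exists_polynomial_eval_eq_coeff_commSymbol q t s a b γ
  have hP0 : P = 0 := by
    refine Polynomial.eq_zero_of_infinite_isRoot P
      ((infinite_setOf_isSeparating_momentCurve hq hq1 s).mono fun v hv => ?_)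
    exact (hP v).trans (coeff_commSymbol_eq_zero_of_isSeparating hq hq_ne_one ht hv a b γ)
  rw [← momentCurve_zero s, ← hP, hP0, Polynomial.eval_zero, map_zero]

theorem weightedOp_weight_comm (hq : q ≠ 0) (hq1 : ‖q‖ < 1) {t : ℂ} (ht : t ≠ 0) (s : Fin n → ℂ)
    (a b : ℕ) (f : AsympSeries n) :
    weightedOp q t (weight s a) (weightedOp q t (weight s b) f) =
      weightedOp q t (weight s b) (weightedOp q t (weight s a) f) := by
  rw [← sub_eq_zero]
  ext γ
  rw [coeff_commutator hq]
  simp only [commSymbol_eq_zero hq hq1 ht, map_zero, zero_mul, Finset.sum_const_zero]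

end Commutator

/-! ### The joint eigenvalue problem for generic parameters -/

section Genericity

lemma prod_one_sub_mul {ι R : Type*} [Fintype ι] [CommRing R] (u : R) (a : ι → R) :
    ∏ i, (1 - u * a i) = 1 + ∑ r ∈ Finset.Icc 1 (Fintype.card ι),
      (-u) ^ r * ∑ I ∈ (Finset.univ : Finset ι).powersetCard r, ∏ i ∈ I, a i := by
  classical
  have hterm (I : Finset ι) : ∏ i ∈ I, -(u * a i) = (-u) ^ I.card * ∏ i ∈ I, a i := by
    rw [← Finset.prod_const, ← Finset.prod_mul_distrib]
    simp only [neg_mul]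
  simp only [sub_eq_add_neg, Finset.prod_one_add, hterm]
  rw [Finset.sum_powerset, Finset.card_univ, Finset.range_eq_Ico,
    Finset.sum_eq_sum_Ico_succ_bot (Nat.succ_pos _), Finset.powersetCard_zero,
    Finset.sum_singleton, Finset.card_empty, pow_zero, Finset.prod_empty, one_mul]
  refine congrArg _ (Finset.sum_congr rfl fun r _ => ?_)
  rw [Finset.mul_sum]
  refine Finset.sum_congr rfl fun I hI => ?_
  rw [(Finset.mem_powersetCard.1 hI).2]

variable {n : ℕ}

/-- The genericity condition on the spectral parameters: they are nonzero, and no ratio of two of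
them is a nontrivial power of `q`. -/
def IsGeneric (q : ℂ) (s : Fin n → ℂ) : Prop :=
  (∀ i, s i ≠ 0) ∧ ∀ i j : Fin n, i ≠ j → ∀ m : ℤ, m ≠ 0 → s j ≠ s i * q ^ m

/-- The weights of the linear combination of the operators with coefficients `c`. -/
noncomputable def combWeight (s : Fin n → ℂ) (c : ℕ → ℂ) (I : Finset (Fin n)) : ℂ :=
  ∑ r ∈ Finset.Icc 1 n, c r * weight s r I

/-- The polynomial `∏ (1 - s_i q ^ (l_i) X)`. Up to its constant term, its values are the diagonal
entries of a linear combination of the operators. -/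
noncomputable def spectralPoly (q : ℂ) (s : Fin n → ℂ) (l : Fin n → ℤ) : Polynomial ℂ :=
  ∏ i, (1 - Polynomial.X * Polynomial.C (s i * q ^ l i))

lemma eval_spectralPoly (q : ℂ) (s : Fin n → ℂ) (l : Fin n → ℤ) (u : ℂ) :
    (spectralPoly q s l).eval u = ∏ i, (1 - u * (s i * q ^ l i)) := by
  simp only [spectralPoly, Polynomial.eval_prod, Polynomial.eval_sub, Polynomial.eval_one,
    Polynomial.eval_mul, Polynomial.eval_X, Polynomial.eval_C]

variable {q : ℂ}

lemma IsGeneric.spectralPoly_ne (hq : q ≠ 0) (hq1 : ‖q‖ < 1) {s : Fin n → ℂ} (hs : IsGeneric q s)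
    {l : Fin n → ℤ} (hl : l ≠ 0) : spectralPoly q s l ≠ spectralPoly q s 0 := by
  intro heq
  obtain ⟨i, hi⟩ := Function.ne_iff.1 hl
  have hne : s i * q ^ l i ≠ 0 := mul_ne_zero (hs.1 i) (zpow_ne_zero _ hq)
  have hroot : (spectralPoly q s 0).eval (s i * q ^ l i)⁻¹ = 0 := by
    rw [← heq, eval_spectralPoly]
    exact Finset.prod_eq_zero (Finset.mem_univ i) (by rw [inv_mul_cancel₀ hne, sub_self])
  rw [eval_spectralPoly] at hroot
  obtain ⟨j, -, hj⟩ := Finset.prod_eq_zero_iff.1 hroot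
  rw [Pi.zero_apply, zpow_zero, mul_one, sub_eq_zero, eq_inv_mul_iff_mul_eq₀ hne, mul_one] at hj
  by_cases hij : i = j
  · subst hij
    have hpow : q ^ l i = q ^ (0 : ℤ) := by
      rw [zpow_zero]
      exact mul_left_cancel₀ (hs.1 i) (by rw [hj, mul_one])
    exact hi (zpow_injective_of_norm_lt_one hq hq1 hpow)
  · exact hs.2 i j hij (l i) hi hj.symm

lemma diagEntry_combWeight (s : Fin n → ℂ) (c : ℕ → ℂ) (l : Fin n → ℤ) :
    diagEntry q (combWeight s c) l = ∑ r ∈ Finset.Icc 1 n, c r * diagEntry q (weight s r) l := by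
  simp only [diagEntry, combWeight, Finset.sum_mul, Finset.mul_sum]
  rw [Finset.sum_comm]
  simp only [mul_assoc]

lemma eval_spectralPoly_eq_diagEntry (hq : q ≠ 0) (s : Fin n → ℂ) (l : Fin n → ℤ) (u : ℂ) :
    (spectralPoly q s l).eval u = 1 + diagEntry q (combWeight s fun r => (-u) ^ r) l := by
  simp only [eval_spectralPoly, prod_one_sub_mul, diagEntry_combWeight, diagEntry_weight hq,
    Fintype.card_fin]

variable [NeZero n]

lemma weightedOp_combWeight (t : ℂ) (s : Fin n → ℂ) (c : ℕ → ℂ) (f : AsympSeries n) :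
    weightedOp q t (combWeight s c) f =
      ∑ r ∈ Finset.Icc 1 n, c r • weightedOp q t (weight s r) f := by
  simp only [weightedOp_apply, combWeight, map_sum, Finset.sum_mul, Finset.smul_sum,
    MvPowerSeries.smul_eq_C_mul, map_mul]
  rw [Finset.sum_comm]
  simp only [mul_assoc]

lemma IsGeneric.exists_isNondegenerate (hq : q ≠ 0) (hq1 : ‖q‖ < 1) {s : Fin n → ℂ}
    (hs : IsGeneric q s) : ∃ c : ℕ → ℂ, IsNondegenerate q (combWeight s c) := by
  obtain ⟨u, hu⟩ := (infinite_setOf_eval_ne_zero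
    (fun l : {l : Fin n → ℤ // l ≠ 0} => spectralPoly q s l - spectralPoly q s 0)
    fun l => sub_ne_zero.2 (hs.spectralPoly_ne hq hq1 l.2)).nonempty
  refine ⟨fun r => (-u) ^ r, fun β hβ heq => ?_⟩
  apply hu ⟨expo β, fun h => hβ (eq_constExp_of_expo_eq_zero h)⟩
  rw [Polynomial.eval_sub, eval_spectralPoly_eq_diagEntry hq, eval_spectralPoly_eq_diagEntry hq,
    heq, sub_self]

lemma isNormalizedSolution_iff (hq : q ≠ 0) (t : ℂ) (s : Fin n → ℂ) (f : AsympSeries n)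
    (ε : ℕ → PowerSeries ℂ) : IsNormalizedSolution q t s f ε ↔ IsNormalized f ∧
      ∀ r ∈ Finset.Icc 1 n, weightedOp q t (weight s r) f = ofNomeSeries (ε r) * f := by
  simp only [← modifiedOp_eq_weightedOp hq]
  exact ⟨fun h => ⟨h.normalized, h.eigen⟩, fun h => ⟨h.2, h.1⟩⟩

theorem IsGeneric.exists_isNormalizedSolution (hq : q ≠ 0) (hq1 : ‖q‖ < 1) {t : ℂ} (ht : t ≠ 0)
    {s : Fin n → ℂ} (hs : IsGeneric q s) : ∃ f ε, IsNormalizedSolution q t s f ε := by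
  obtain ⟨c, hc⟩ := hs.exists_isNondegenerate hq hq1
  have hcomm (r : ℕ) (f : AsympSeries n) :
      weightedOp q t (combWeight s c) (weightedOp q t (weight s r) f) =
        weightedOp q t (weight s r) (weightedOp q t (combWeight s c) f) := by
    simp only [weightedOp_combWeight, map_sum, map_smul, weightedOp_weight_comm hq hq1 ht s _ r]
  obtain ⟨f, hf, heigen⟩ := exists_joint_eigenfunction hq t hc (weight s) hcomm
  choose η hη using heigen
  exact ⟨f, η, (isNormalizedSolution_iff hq t s f η).2 ⟨hf, fun r _ => hη r⟩⟩

/-- The inclusion of `ℂ⟦p⟧` as a linear map. -/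
noncomputable def ofNomeLinear (n : ℕ) [NeZero n] : PowerSeries ℂ →ₗ[ℂ] AsympSeries n where
  toFun := ofNomeSeries
  map_add' ε η := by
    ext β
    simp only [map_add, coeff_ofNomeSeries]
    split_ifs <;> simp
  map_smul' c ε := by
    ext β
    simp only [map_smul, coeff_ofNomeSeries, RingHom.id_apply]
    split_ifs <;> simp

lemma weightedOp_combWeight_eq_of_forall (t : ℂ) {s : Fin n → ℂ} (c : ℕ → ℂ) {f : AsympSeries n}
    {ε : ℕ → PowerSeries ℂ}
    (h : ∀ r ∈ Finset.Icc 1 n, weightedOp q t (weight s r) f = ofNomeSeries (ε r) * f) :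
    weightedOp q t (combWeight s c) f = ofNomeSeries (∑ r ∈ Finset.Icc 1 n, c r • ε r) * f := by
  change _ = ofNomeLinear n _ * f
  rw [weightedOp_combWeight, map_sum, Finset.sum_mul]
  refine Finset.sum_congr rfl fun r hr => ?_
  rw [h r hr, map_smul, smul_mul_assoc]
  rfl

theorem IsGeneric.isNormalizedSolution_unique (hq : q ≠ 0) (hq1 : ‖q‖ < 1) {t : ℂ}
    {s : Fin n → ℂ} (hs : IsGeneric q s) {f g : AsympSeries n} {ε η : ℕ → PowerSeries ℂ}
    (hf : IsNormalizedSolution q t s f ε) (hg : IsNormalizedSolution q t s g η) :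
    f = g ∧ ∀ r ∈ Finset.Icc 1 n, ε r = η r := by
  obtain ⟨c, hc⟩ := hs.exists_isNondegenerate hq hq1
  rw [isNormalizedSolution_iff hq] at hf hg
  have hfg : f = g := eigenfunction_unique hq t hc hf.1 hg.1
    (weightedOp_combWeight_eq_of_forall t c hf.2) (weightedOp_combWeight_eq_of_forall t c hg.2)
  subst hfg
  exact ⟨rfl, fun r hr => (eq_forcedEigenvalue hq t hf.1 (hf.2 r hr)).trans
    (eq_forcedEigenvalue hq t hf.1 (hg.2 r hr)).symm⟩

end Genericity

/-! ### Rotation of the variables -/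

section Rotation

variable {n : ℕ}

lemma isGeneric_of_lt {q : ℂ} {s : Fin n → ℂ} (hs0 : ∀ i, s i ≠ 0)
    (hs : ∀ i j : Fin n, i < j → ∀ m : ℤ, m ≠ 0 → s j / s i ≠ q ^ m) : IsGeneric q s := by
  refine ⟨hs0, fun i j hij m hm h => ?_⟩
  rcases lt_or_gt_of_ne hij with hlt | hlt
  · exact hs i j hlt m hm (by rw [h, mul_div_cancel_left₀ _ (hs0 i)])
  · refine hs j i hlt (-m) (neg_ne_zero.2 hm) ?_
    rw [h, zpow_neg, div_mul_cancel_left₀ (hs0 i)]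

variable [NeZero n]

/-- The exponent `k ↦ β (k + 1)`: the coefficient of `z ^ β` in `rotateSeries f` is the coefficient
of `z ^ rotateExp n β` in `f`. -/
noncomputable def rotateExp (n : ℕ) [NeZero n] : (Fin n →₀ ℕ) ≃ (Fin n →₀ ℕ) :=
  Finsupp.equivCongrLeft (Equiv.addRight (1 : Fin n)).symm

lemma rotateExp_apply (β : Fin n →₀ ℕ) (k : Fin n) : rotateExp n β k = β (k + 1) := rfl

lemma rotateExp_eq (β : Fin n →₀ ℕ) :
    rotateExp n β = Finsupp.equivFunOnFinite.symm fun k : Fin n => β (k + 1) := by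
  ext k
  rfl

/-- The substitution `z_k ↦ z_{k + 1}` of `rotateSeries` as a ring homomorphism. -/
noncomputable def rotateHom (n : ℕ) [NeZero n] : AsympSeries n →+* AsympSeries n :=
  (MvPowerSeries.rename (Equiv.addRight (1 : Fin n)).toEmbedding : _ →ₐ[ℂ] _).toRingHom

lemma coeff_rotateHom (f : AsympSeries n) (β : Fin n →₀ ℕ) :
    MvPowerSeries.coeff β (rotateHom n f) = MvPowerSeries.coeff (rotateExp n β) f := by
  have h : β = Finsupp.embDomain (Equiv.addRight (1 : Fin n)).toEmbedding (rotateExp n β) := by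
    ext k
    obtain ⟨j, rfl⟩ := (Equiv.addRight (1 : Fin n)).surjective k
    exact (Finsupp.embDomain_apply_self (Equiv.addRight (1 : Fin n)).toEmbedding
      (rotateExp n β) j).symm
  conv_lhs => rw [h]
  exact MvPowerSeries.coeff_embDomain_rename _ _ _

lemma rotateHom_eq (f : AsympSeries n) : rotateHom n f = rotateSeries f := by
  ext β
  rw [coeff_rotateHom, rotateExp_eq]
  rfl

lemma rotateHom_C (c : ℂ) : rotateHom n (MvPowerSeries.C c) = MvPowerSeries.C c :=
  MvPowerSeries.rename_C _ c

lemma rotateHom_X (k : Fin n) :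
    rotateHom n (MvPowerSeries.X k) = MvPowerSeries.X (k + 1) :=
  MvPowerSeries.rename_X _ k

lemma rotateHom_nome : rotateHom n (nome n) = nome n := by
  simp only [nome, map_prod, rotateHom_X]
  exact Equiv.prod_comp (Equiv.addRight (1 : Fin n)) fun k => (MvPowerSeries.X k : AsympSeries n)

lemma rotateHom_prodX_cyclicIoc {i j : Fin n} (h : i ≠ j) :
    rotateHom n (prodX (cyclicIoc i j)) = prodX (cyclicIoc (i + 1) (j + 1)) := by
  simp only [prodX, map_prod, rotateHom_X]
  exact Finset.prod_equiv (Equiv.addRight 1) (fun k => (add_one_mem_cyclicIoc_add_one h).symm)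
    fun k _ => rfl

lemma rotateHom_pochhammer (a : AsympSeries n) :
    rotateHom n (pochhammer a) = pochhammer (rotateHom n a) := by
  refine map_pochhammer _ (fun _ => 1) (rotateExp n) (fun β => ?_) (fun f β => ?_)
    rotateHom_nome a
  · rw [Finsupp.degree_eq_sum, Finsupp.degree_eq_sum]
    exact Equiv.sum_comp (Equiv.addRight (1 : Fin n)) fun k => β k
  · rw [coeff_rotateHom, one_mul]

lemma rotateHom_thetaPair (c : ℂ) {i j : Fin n} (h : i ≠ j) :
    rotateHom n (thetaPair c i j) = thetaPair c (i + 1) (j + 1) := by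
  simp only [thetaPair, map_mul, rotateHom_pochhammer, rotateHom_C, rotateHom_prodX_cyclicIoc h,
    rotateHom_prodX_cyclicIoc h.symm]

lemma rotateHom_inv {f : AsympSeries n} (hf : MvPowerSeries.constantCoeff f = 1) :
    rotateHom n f⁻¹ = (rotateHom n f)⁻¹ := by
  have h0 : MvPowerSeries.constantCoeff (rotateHom n f) ≠ 0 := by
    rw [← MvPowerSeries.coeff_zero_eq_constantCoeff_apply, coeff_rotateHom,
      show rotateExp n 0 = 0 from by ext; rfl, MvPowerSeries.coeff_zero_eq_constantCoeff_apply, hf]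
    exact one_ne_zero
  rw [MvPowerSeries.eq_inv_iff_mul_eq_one h0, ← map_mul, MvPowerSeries.inv_mul_cancel, map_one]
  rw [hf]
  exact one_ne_zero

lemma rotateHom_pairCoeff (c d : ℂ) {i j : Fin n} (h : i ≠ j) :
    rotateHom n (pairCoeff c d i j) = pairCoeff c d (i + 1) (j + 1) := by
  rw [pairCoeff, map_mul, rotateHom_inv (constantCoeff_thetaPair d _ _), rotateHom_thetaPair _ h,
    rotateHom_thetaPair _ h, pairCoeff]

/-- The set `{i + 1 | i ∈ I}`, on which the shift `T^I` acts after the rotation. -/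
def rotateSet (n : ℕ) [NeZero n] : Finset (Fin n) ≃ Finset (Fin n) :=
  (Equiv.addRight (1 : Fin n)).finsetCongr

lemma add_one_mem_rotateSet {I : Finset (Fin n)} {i : Fin n} :
    i + 1 ∈ rotateSet n I ↔ i ∈ I :=
  Finset.mem_map' (Equiv.addRight (1 : Fin n)).toEmbedding

lemma card_rotateSet (I : Finset (Fin n)) : (rotateSet n I).card = I.card :=
  Finset.card_map _

lemma compl_rotateSet (I : Finset (Fin n)) : (rotateSet n I)ᶜ = rotateSet n Iᶜ := by
  ext k
  obtain ⟨j, rfl⟩ := (Equiv.addRight (1 : Fin n)).surjective k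
  change j + 1 ∈ _ ↔ j + 1 ∈ _
  simp only [Finset.mem_compl, add_one_mem_rotateSet]

lemma prod_rotateSet {M : Type*} [CommMonoid M] (I : Finset (Fin n)) (g : Fin n → M) :
    ∏ i ∈ rotateSet n I, g i = ∏ i ∈ I, g (i + 1) :=
  Finset.prod_map _ _ _

lemma rotateHom_opCoeff (t : ℂ) (I : Finset (Fin n)) :
    rotateHom n (opCoeff t I) = opCoeff t (rotateSet n I) := by
  rw [opCoeff_eq, opCoeff_eq, compl_rotateSet, prod_rotateSet, map_prod]
  refine Finset.prod_congr rfl fun i hi => ?_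
  rw [prod_rotateSet, map_prod]
  refine Finset.prod_congr rfl fun j hj => rotateHom_pairCoeff t 1 ?_
  rintro rfl
  exact Finset.mem_compl.1 hj hi

lemma rotateHom_qShift (q : ℂ) (I : Finset (Fin n)) (f : AsympSeries n) :
    rotateHom n (qShift q I f) = qShift q (rotateSet n I) (rotateHom n f) := by
  ext β
  rw [coeff_rotateHom]
  change (∏ i ∈ I, _) * _ = (∏ i ∈ rotateSet n I, _) * MvPowerSeries.coeff β (rotateHom n f)
  rw [prod_rotateSet, coeff_rotateHom]
  rfl

lemma rotateHom_modifiedOp (q t : ℂ) (s : Fin n → ℂ) (r : ℕ) (f : AsympSeries n) :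
    rotateHom n (modifiedOp q t (rotateParam s) r f) = modifiedOp q t s r (rotateHom n f) := by
  simp only [modifiedOp, map_sum, map_mul, rotateHom_C, rotateHom_opCoeff, rotateHom_qShift]
  refine Finset.sum_equiv (rotateSet n) (fun I => ?_) fun I _ => ?_
  · simp only [Finset.mem_powersetCard, Finset.subset_univ, true_and, card_rotateSet]
  · rw [prod_rotateSet]
    rfl

lemma rotateHom_ofNomeSeries (ε : PowerSeries ℂ) :
    rotateHom n (ofNomeSeries ε) = ofNomeSeries ε := by
  ext β
  rw [coeff_rotateHom]
  change (if ∀ i, β (i + 1) = β (0 + 1) then PowerSeries.coeff (β (0 + 1)) ε else 0) =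
    if ∀ i, β i = β 0 then PowerSeries.coeff (β 0) ε else 0
  by_cases h : ∀ i, β i = β 0
  · rw [if_pos h, if_pos fun i => by rw [h, h (0 + 1)], h (0 + 1)]
  · rw [if_neg h, if_neg fun h' => h fun i => ?_]
    rw [← sub_add_cancel i 1, h', ← h' (0 - 1), sub_add_cancel]

lemma IsNormalizedSolution.rotateHom {q t : ℂ} {s : Fin n → ℂ} {f : AsympSeries n}
    {ε : ℕ → PowerSeries ℂ} (h : IsNormalizedSolution q t (rotateParam s) f ε) :
    IsNormalizedSolution q t s (rotateHom n f) ε where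
  eigen r hr := by
    rw [← rotateHom_modifiedOp, h.eigen r hr, map_mul, rotateHom_ofNomeSeries]
  normalized k := by
    rw [coeff_rotateHom, ← h.normalized k, rotateExp_eq]
    rfl

lemma IsGeneric.rotateParam {q : ℂ} {s : Fin n → ℂ} (h : IsGeneric q s) :
    IsGeneric q (rotateParam s) :=
  ⟨fun i => h.1 (i + 1), fun i j hij => h.2 (i + 1) (j + 1) fun e => hij (add_right_cancel e)⟩

theorem IsGeneric.rotateSeries_series {q t : ℂ} (hq : q ≠ 0) (hq1 : ‖q‖ < 1) (ht : t ≠ 0)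
    {s : Fin n → ℂ} (hs : IsGeneric q s) :
    rotateSeries (series q t (Ruijsenaars.rotateParam s)) = series q t s ∧
      ∀ r ∈ Finset.Icc 1 n, eigenvalue q t (Ruijsenaars.rotateParam s) r = eigenvalue q t s r := by
  rw [← rotateHom_eq]
  exact hs.isNormalizedSolution_unique hq hq1
    (isNormalizedSolution_series (hs.rotateParam.exists_isNormalizedSolution hq hq1 ht)).rotateHom
    (isNormalizedSolution_series (hs.exists_isNormalizedSolution hq hq1 ht))

lemma asympVar_rotatePoint {p : ℂ} (hp : p ≠ 0) (x : Fin n → ℂ) (k : Fin n) :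
    asympVar p (rotatePoint p x) k = asympVar p x (k + 1) := by
  have hsucc {m : Fin n} (hm : m + 1 ≠ 0) : rotatePoint p x m = x (m + 1) := if_neg hm
  have hwrap {m : Fin n} (hm : m + 1 = 0) : rotatePoint p x m = p * x 0 := if_pos hm
  by_cases hk : k = 0
  · subst hk
    rw [asympVar, if_pos rfl, hwrap (neg_add_cancel 1), asympVar]
    by_cases h1 : (0 : Fin n) + 1 = 0
    · have hm : (-1 : Fin n) = 0 := by rw [neg_eq_zero, ← zero_add (1 : Fin n), h1]
      rw [if_pos h1, hwrap h1, hm, mul_div_mul_left _ _ hp]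
    · rw [if_neg h1, hsucc h1, mul_div_mul_left _ _ hp, add_sub_cancel_right]
  · rw [asympVar, if_neg hk, hsucc (m := k - 1) (by rwa [sub_add_cancel]), sub_add_cancel, asympVar]
    by_cases h1 : k + 1 = 0
    · rw [if_pos h1, hwrap h1, eq_neg_of_add_eq_zero_left h1]
    · rw [if_neg h1, hsucc h1, add_sub_cancel_right]

lemma term_rotatePoint {q t : ℂ} {s : Fin n → ℂ}
    (h : rotateSeries (series q t (rotateParam s)) = series q t s) {p : ℂ} (hp : p ≠ 0)
    (x : Fin n → ℂ) (β : Fin n →₀ ℕ) :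
    term q t (rotatePoint p x) (rotateParam s) p (rotateExp n β) = term q t x s p β := by
  rw [term, term, ← h, ← rotateHom_eq, coeff_rotateHom]
  congr 1
  simp only [asympVar_rotatePoint hp, rotateExp_apply]
  exact Equiv.prod_comp (Equiv.addRight (1 : Fin n)) fun k => asympVar p x k ^ β k

end Rotation

end Ruijsenaars

theorem theorem2p7 {n : ℕ} [NeZero n] (q t : ℂ) (hq0 : q ≠ 0) (hq1 : ‖q‖ < 1) (ht : t ≠ 0)
    (s : Fin n → ℂ) (hs0 : ∀ i, s i ≠ 0)
    (hs : ∀ i j : Fin n, i < j → ∀ m : ℤ, m ≠ 0 → s j / s i ≠ q ^ m) :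
    -- the identity of formal power series
    Ruijsenaars.rotateSeries (Ruijsenaars.series q t (Ruijsenaars.rotateParam s)) =
      Ruijsenaars.series q t s ∧
    -- the identity of functions: the series converge absolutely at the same points, and agree
    (∀ (p : ℂ) (x : Fin n → ℂ), p ≠ 0 → (∀ i, x i ≠ 0) →
      (Summable (Ruijsenaars.term q t (Ruijsenaars.rotatePoint p x) (Ruijsenaars.rotateParam s) p) ↔
        Summable (Ruijsenaars.term q t x s p)) ∧
      Ruijsenaars.ruijsenaars q t (Ruijsenaars.rotatePoint p x) (Ruijsenaars.rotateParam s) p =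
        Ruijsenaars.ruijsenaars q t x s p) ∧
    -- the eigenvalues
    ∀ r ∈ Finset.Icc 1 n,
      Ruijsenaars.eigenvalue q t (Ruijsenaars.rotateParam s) r = Ruijsenaars.eigenvalue q t s r := by
  obtain ⟨hseries, heigenvalue⟩ :=
    (Ruijsenaars.isGeneric_of_lt hs0 hs).rotateSeries_series hq0 hq1 ht
  refine ⟨hseries, fun p x hp _ => ?_, heigenvalue⟩
  have hterm := Ruijsenaars.term_rotatePoint hseries hp x
  constructor
  · rw [← (Ruijsenaars.rotateExp n).summable_iff]
    exact summable_congr hterm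
  · rw [Ruijsenaars.ruijsenaars, ← (Ruijsenaars.rotateExp n).tsum_eq]
    exact tsum_congr hterm
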